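/- Let $P$ be a finite connected graph (loops and multiple edges allowed), every edge having length $1$, with first Betti number $b\ge 1$. For $\theta\in\Gamma=H_1(P,\mathbb Z)$ let $l_\theta$ be the smallest length of a closed edge path in the homology class $\theta$. The stable norm $\|\cdot\|_{st}$ on $H_1(P,\mathbb R)$ is the extension by homogeneity and continuity of $\|\theta\|_{st}=\lim_{n\to\infty} l_{n\theta}/n$ on $\Gamma$. Let $V$ be the volume of its unit ball for the Haar measure on $H_1(P,\mathbb R)$ for which the lattice $\Gamma$ has covolume $1$. Put $$\zeta_{st}(z)=\sum_{\theta\in\Gamma\setminus\{0\}}\frac1{\|\theta\|_{st}^{z}},$$ where the series is said to converge at $z\in\mathbb C$ if, for every $t>0$, only finitely many $\theta\in\Gamma\setminus\{0\}$ have $\|\theta\|_{st}\le t$, and the sum of the corresponding terms has a limit as $t\to\infty$. Then: 1) The series converges if and only if $\operatorname{Re} z>b$. 2) The function $\zeta_{st}$ extends to a meromorphic function on $\mathbb C$, which is holomorphic outside $\{1,2,\dots,b\}$, has at most a simple pole at each of the points $1,\dots,b$, and has a simple pole at $z=b$ with residue $bV$. 3) There are an integer $m\ge 1$ and rational numbers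 $p_{lk}$ ($0\le l\le b-1$, $1\le k\le m$), depending only on $P$, such that for all $z\in\mathbb C\setminus\{1,\dots,b\}$ $$\zeta_{st}(z)=bV\,\zeta(z-b+1)+\sum_{l=0}^{b-1}m^{l-z}\sum_{k=1}^m p_{lk}\,\zeta\Big(z-l;\frac km\Big),$$ where $\zeta(s)$ is the Riemann zeta function and $\zeta(s;q)$ is the Hurwitz zeta function, the meromorphic continuation in $s$ of $\sum_{n\ge 0}(q+n)^{-s}$. -/

import Mathlib

open Filter Topology MeasureTheory
open scoped Graph

namespace StableZeta

/-! Mathlib's `Graph α β` is an undirected graph with loops and multiple edges allowed,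
with vertex set `V(G)` and edge set `E(G)`. Every edge is given length `1`. -/

/-- `G` is connected: it has a vertex, and any two vertices are joined by a chain of edges. -/
def Connected {α β : Type*} (G : Graph α β) : Prop :=
  V(G).Nonempty ∧ ∀ x ∈ V(G), ∀ y ∈ V(G), Relation.ReflTransGen G.Adj x y

section

variable {α β : Type*} (G : Graph α β)

theorem exists_ends (e : E(G)) : ∃ p : V(G) × V(G), G.IsLink e p.1 p.2 := by
  obtain ⟨x, y, h⟩ := Graph.exists_isLink_of_mem_edgeSet e.2
  exact ⟨(⟨x, h.left_mem⟩, ⟨y, h.right_mem⟩), h⟩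

/-- The two ends of an edge, in an arbitrarily chosen order: this fixes a reference orientation
of every edge, as is needed to write cellular chains. -/
noncomputable def ends (e : E(G)) : V(G) × V(G) := (exists_ends G e).choose

theorem isLink_ends (e : E(G)) : G.IsLink e (ends G e).1 (ends G e).2 :=
  (exists_ends G e).choose_spec

variable [Fintype E(G)]

/-- The cellular boundary map `C₁(G; R) → C₀(G; R)`, sending an oriented edge to its
terminal end minus its initial end. -/
noncomputable def boundary (R : Type*) [CommRing R] : (E(G) → R) →ₗ[R] (V(G) →₀ R) :=
  Fintype.linearCombination R
    (fun e : E(G) => Finsupp.single (ends G e).2 (1 : R) - Finsupp.single (ends G e).1 (1 : R))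

/-- First cellular homology with coefficients in `R`. There are no `2`-cells, so it is the
module of `1`-cycles. For `R = ℤ` it is torsion free. -/
noncomputable abbrev H1 (R : Type*) [CommRing R] : Submodule R (E(G) → R) :=
  LinearMap.ker (boundary G R)

theorem intCast_mem_H1 (c : H1 G ℤ) : (fun e => ((c : E(G) → ℤ) e : ℝ)) ∈ H1 G ℝ := by
  have h : boundary G ℤ c.1 = 0 := c.2
  rw [LinearMap.mem_ker]
  ext v
  have hv := congrArg (fun f : V(G) →₀ ℤ => ((f v : ℤ) : ℝ)) h
  classical
  simp [boundary, Fintype.linearCombination_apply, Finsupp.finsetSum_apply,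
    Finsupp.single_apply] at hv ⊢
  exact hv

/-- The canonical embedding `H₁(G; ℤ) → H₁(G; ℝ)`. -/
noncomputable def toReal : H1 G ℤ →ₗ[ℤ] H1 G ℝ where
  toFun c := ⟨fun e => ((c : E(G) → ℤ) e : ℝ), intCast_mem_H1 G c⟩
  map_add' a b := by ext e; simp
  map_smul' n a := by ext e; simp

/-- The lattice of integral classes in `H₁(G; ℝ)`. -/
noncomputable def lattice : Submodule ℤ (H1 G ℝ) := LinearMap.range (toReal G)

/-- The first Betti number. -/
noncomputable def betti : ℕ := Module.finrank ℝ (H1 G ℝ)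

open Classical in
/-- `IsWalk G u v n c`: there is an edge path from `u` to `v` of length `n` whose `1`-chain is
`c`. Edges may be traversed in both directions (with sign `+1` or `-1`) and repeated. -/
inductive IsWalk : V(G) → V(G) → ℕ → (E(G) → ℤ) → Prop
  | nil (u : V(G)) : IsWalk u u 0 0
  | forward {u : V(G)} {n : ℕ} {c : E(G) → ℤ} (e : E(G)) (h : IsWalk u (ends G e).1 n c) :
      IsWalk u (ends G e).2 (n + 1) (c + Pi.single e 1)
  | backward {u : V(G)} {n : ℕ} {c : E(G) → ℤ} (e : E(G)) (h : IsWalk u (ends G e).2 n c) :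
      IsWalk u (ends G e).1 (n + 1) (c - Pi.single e 1)

/-- `l_θ`: the smallest length of a (connected) closed edge path in the homology class `θ`. -/
noncomputable def minLength (θ : H1 G ℤ) : ℕ :=
  sInf {n : ℕ | ∃ u : V(G), IsWalk G u u n θ}

/-- The stable norm of an integral class `θ`, the limit of `l_{nθ} / n`. -/
noncomputable def stableNormInt (θ : H1 G ℤ) : ℝ :=
  limUnder atTop (fun n : ℕ => (minLength G (n • θ) : ℝ) / n)

/-- The stable norm on `H₁(G; ℝ)`: the extension of `stableNormInt` by homogeneity (to rational
classes `θ / q`) and continuity (the limit over the rational classes that tend to `x`). -/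
noncomputable def stableNorm (x : H1 G ℝ) : ℝ :=
  limUnder (comap (fun p : ℕ+ × H1 G ℤ => ((p.1 : ℕ) : ℝ)⁻¹ • toReal G p.2) (𝓝 x))
    (fun p : ℕ+ × H1 G ℤ => ((p.1 : ℕ) : ℝ)⁻¹ * stableNormInt G p.2)

/-- The Haar measure on `H₁(G; ℝ)` for which the lattice of integral classes has covolume `1`. -/
noncomputable def normalizedHaar : Measure (H1 G ℝ) :=
  ENNReal.ofReal (ZLattice.covolume (lattice G) Measure.addHaar)⁻¹ • Measure.addHaar

/-- The volume of the unit ball of the stable norm. -/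
noncomputable def ballVolume : ℝ :=
  (normalizedHaar G {x : H1 G ℝ | stableNorm G x ≤ 1}).toReal

end

/-- The series `∑_{θ ∈ Θ} 1 / l(θ) ^ z` of a family `l` converges to `s`: only finitely many
`θ` have `l(θ) ≤ t`, for every `t`, and the sum over them tends to `s` as `t → ∞`. -/
def ZetaConvergesTo {Θ : Type*} (l : Θ → ℝ) (z s : ℂ) : Prop :=
  (∀ t : ℝ, {θ : Θ | l θ ≤ t}.Finite) ∧
    Tendsto (fun t : ℝ => ∑ᶠ θ ∈ {θ : Θ | l θ ≤ t}, 1 / ((l θ : ℝ) : ℂ) ^ z) atTop (𝓝 s)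

/-- The stable zeta series of `G`, over all nonzero integral classes, converges at `z` to `s`. -/
def StableZetaConvergesTo {α β : Type*} (G : Graph α β) [Fintype E(G)] (z s : ℂ) : Prop :=
  ZetaConvergesTo (fun θ : {θ : H1 G ℤ // θ ≠ 0} => stableNorm G (toReal G θ)) z s

end StableZeta

/-!
The stable norm of a graph is the `ℓ¹` norm of cycles (`stableNorm_eq`). The reason is conformal
decomposition: the support of a nonzero cycle, oriented by its signs, contains a directed closed
path without repeated edges (`exists_conformal_cycle`), which can be split off with additivity of
the norm. Hence the class `n θ` is realized by a closed walk that runs `n` times through each of the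
closed paths making up `θ`, plus connecting paths whose length does not depend on `n`. So the stable
zeta function is the Dirichlet series `∑ r(n) / n ^ z`, where `r(n)` is the number of integral cycles
of `ℓ¹` norm `n`.

For `n ≥ 1` the sequence `r` is a quasi-polynomial of degree less than `b`. To see this, sort the
cycles by their signs. If `c` is a directed closed path contained in cycles with signs `σ`, then
subtracting `c` maps the cycles with signs `σ` and norm `n + |c|` bijectively onto the cycles of norm
`n` whose signs arise from `σ` by deleting a possibly empty set of edges of `c` (`signCount_add`).
So the difference of the count with step `|c|` is a sum of counts over cones of smaller dimension,
and by induction the `b`-th difference of `r`, with a step `m` divisible by all these lengths,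
vanishes at all `n ≥ 1` (`diffVanishes_card_sphere`). Newton's formula gives the quasi-polynomial
(`exists_quasiPolynomial`), with rational coefficients. The series is therefore a finite sum of
shifted `L`-functions of functions on `ZMod m`, which are combinations of Hurwitz zeta functions and
have at most simple poles (`quasiZeta`).

Counting lattice points in the dilates of the unit ball gives `∑_{k ≤ n} r(k) ∼ V n ^ b`
(`tendsto_ncard_div`). This fixes the average of the leading coefficients of the quasi-polynomial,
hence the residue `b V` (`sum_leadingCoeff_eq`); as that average is rational, `b V` can be split off
as a multiple of the Riemann zeta function. The same asymptotics make blocks of the series too large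
for convergence when `Re z ≤ b` (`not_tendsto_of_re_le`).
-/

namespace StableZeta

/-! ### Edge paths -/

/-- The `ℓ¹` norm of an integral chain. -/
def size {ι : Type*} [Fintype ι] (c : ι → ℤ) : ℕ := ∑ e, (c e).natAbs

/-- The `ℓ¹` norm of a real chain. -/
def l1 {ι : Type*} [Fintype ι] (x : ι → ℝ) : ℝ := ∑ e, |x e|

section chains

variable {ι : Type*} [Fintype ι]

theorem l1_intCast (c : ι → ℤ) : l1 (fun e => (c e : ℝ)) = size c := by
  simp [l1, size, Nat.cast_natAbs]

theorem size_add_le (c d : ι → ℤ) : size (c + d) ≤ size c + size d := by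
  rw [size, size, size, ← Finset.sum_add_distrib]
  exact Finset.sum_le_sum fun e _ => Int.natAbs_add_le _ _

theorem size_neg (c : ι → ℤ) : size (-c) = size c := by simp [size]

theorem size_single [DecidableEq ι] (e : ι) (a : ℤ) : size (Pi.single e a) = a.natAbs := by
  rw [size, Finset.sum_eq_single e]
  · simp
  · intro f _ hf
    simp [hf]
  · simp

theorem size_eq_zero {c : ι → ℤ} : size c = 0 ↔ c = 0 := by
  simp [size, funext_iff]

theorem size_nsmul (n : ℕ) (c : ι → ℤ) : size (n • c) = n * size c := by
  simp [size, Int.natAbs_mul, Finset.mul_sum]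

end chains

section graph

variable {α β : Type*} {G : Graph α β}

theorem IsWalk.append {u v w : V(G)} {n k : ℕ} {c d : E(G) → ℤ} (h : IsWalk G u v n c)
    (h' : IsWalk G v w k d) : IsWalk G u w (n + k) (c + d) := by
  induction h' with
  | nil => simpa using h
  | forward e _ ih =>
    rw [← add_assoc, ← add_assoc]
    exact ih.forward e
  | backward e _ ih =>
    rw [← add_assoc, ← add_sub_assoc]
    exact ih.backward e

theorem IsWalk.reverse {u v : V(G)} {n : ℕ} {c : E(G) → ℤ} (h : IsWalk G u v n c) :
    IsWalk G v u n (-c) := by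
  classical
  induction h with
  | nil => simpa using IsWalk.nil _
  | forward e _ ih =>
    have := ((IsWalk.nil (ends G e).2).backward e).append ih
    rw [show (0 + 1 + _ : ℕ) = _ + 1 by ring] at this
    convert this using 1
    rw [zero_sub]
    abel
  | backward e _ ih =>
    have := ((IsWalk.nil (ends G e).1).forward e).append ih
    rw [show (0 + 1 + _ : ℕ) = _ + 1 by ring] at this
    convert this using 1
    abel

theorem IsWalk.repeat {u : V(G)} {n : ℕ} {c : E(G) → ℤ} (h : IsWalk G u u n c) (k : ℕ) :
    IsWalk G u u (k * n) (k • c) := by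
  induction k with
  | zero => simpa using IsWalk.nil u
  | succ k ih =>
    rw [add_mul, one_mul, add_smul, one_smul]
    exact ih.append h

theorem exists_isWalk (hG : Connected G) (u v : V(G)) :
    ∃ n c, IsWalk G u v n c := by
  obtain ⟨v, hv⟩ := v
  have key := hG.2 u u.2 v hv
  induction key with
  | refl => exact ⟨0, 0, IsWalk.nil u⟩
  | @tail x y _ hxy ih =>
    obtain ⟨n, c, h⟩ := ih hxy.left_mem
    obtain ⟨e, he⟩ : ∃ e : E(G), G.IsLink e x y := by
      obtain ⟨e, he⟩ := hxy
      exact ⟨⟨e, he.edge_mem⟩, he⟩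
    rcases he.eq_and_eq_or_eq_and_eq (isLink_ends G e) with ⟨h1, h2⟩ | ⟨h1, h2⟩
    · subst h1 h2
      exact ⟨_, _, h.forward e⟩
    · subst h1 h2
      exact ⟨_, _, h.backward e⟩

/-- The initial end of an edge, oriented by the sign of the chain `x` on it. -/
noncomputable def tail (x : E(G) → ℝ) (e : E(G)) : V(G) :=
  if 0 < x e then (ends G e).1 else (ends G e).2

/-- The terminal end of an edge, oriented by the sign of the chain `x` on it. -/
noncomputable def head (x : E(G) → ℝ) (e : E(G)) : V(G) :=
  if 0 < x e then (ends G e).2 else (ends G e).1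

open Classical in
theorem IsWalk.step {x : E(G) → ℝ} {e : E(G)} (he : x e ≠ 0) {u : V(G)} {n : ℕ} {c : E(G) → ℤ}
    (h : IsWalk G u (tail x e) n c) :
    IsWalk G u (head x e) (n + 1) (c + Pi.single e (SignType.sign (x e) : ℤ)) := by
  rcases lt_or_gt_of_ne he with h0 | h0
  · rw [tail, if_neg h0.not_gt] at h
    rw [head, if_neg h0.not_gt, sign_neg h0, SignType.coe_neg_one, Pi.single_neg, ← sub_eq_add_neg]
    exact h.backward e
  · rw [tail, if_pos h0] at h
    rw [head, if_pos h0, sign_pos h0, SignType.coe_one]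
    exact h.forward e

variable [Fintype E(G)]

theorem IsWalk.size_le {u v : V(G)} {n : ℕ} {c : E(G) → ℤ} (h : IsWalk G u v n c) :
    size c ≤ n := by
  classical
  induction h with
  | nil => simp [size]
  | forward e _ ih =>
    refine (size_add_le _ _).trans (add_le_add ih ?_)
    rw [size_single, Int.natAbs_one]
  | backward e _ ih =>
    rw [sub_eq_add_neg]
    refine (size_add_le _ _).trans (add_le_add ih ?_)
    rw [size_neg, size_single, Int.natAbs_one]

theorem IsWalk.boundary_eq {u v : V(G)} {n : ℕ} {c : E(G) → ℤ} (h : IsWalk G u v n c) :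
    boundary G ℤ c = Finsupp.single v 1 - Finsupp.single u 1 := by
  classical
  have hs (e : E(G)) : boundary G ℤ (Pi.single e 1) =
      Finsupp.single (ends G e).2 1 - Finsupp.single (ends G e).1 1 := by
    rw [boundary, Fintype.linearCombination_apply_single, one_smul]
  induction h with
  | nil => simp
  | forward e _ ih =>
    rw [map_add, ih, hs]
    abel
  | backward e _ ih =>
    rw [map_sub, ih, hs]
    abel

theorem IsWalk.mem_H1 {u : V(G)} {n : ℕ} {c : E(G) → ℤ} (h : IsWalk G u u n c) :
    c ∈ H1 G ℤ := by
  rw [LinearMap.mem_ker, h.boundary_eq, sub_self]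

/-! ### Directed cycles in the support of a real cycle -/

open Classical in
theorem boundary_apply_eq (x : E(G) → ℝ) (v : V(G)) :
    boundary G ℝ x v =
      ∑ e, |x e| * ((if head x e = v then 1 else 0) - (if tail x e = v then 1 else 0)) := by
  simp only [boundary, Fintype.linearCombination_apply, Finsupp.finsetSum_apply, Finsupp.smul_apply,
    Finsupp.sub_apply, Finsupp.single_apply, smul_eq_mul]
  refine Finset.sum_congr rfl fun e _ => ?_
  rw [head, tail]
  rcases lt_or_ge 0 (x e) with h | h
  · rw [if_pos h, if_pos h, abs_of_pos h]
  · rw [if_neg h.not_gt, if_neg h.not_gt, abs_of_nonpos h]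
    ring

/-- A flow that enters a vertex also leaves it. -/
theorem exists_next {x : E(G) → ℝ} (hx : x ∈ H1 G ℝ) {e : E(G)} (he : x e ≠ 0) :
    ∃ f, x f ≠ 0 ∧ tail x f = head x e := by
  classical
  by_contra! hcon
  have h0 := boundary_apply_eq x (head x e)
  rw [LinearMap.mem_ker.mp hx, Finsupp.zero_apply] at h0
  have hnn : ∀ f ∈ Finset.univ, 0 ≤ |x f| * ((if head x f = head x e then 1 else 0) -
      (if tail x f = head x e then (1 : ℝ) else 0)) := by
    intro f _
    by_cases hf : x f = 0
    · simp [hf]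
    · rw [if_neg (hcon f hf), sub_zero]
      positivity
  have := (Finset.sum_eq_zero_iff_of_nonneg hnn).mp h0.symm e (Finset.mem_univ e)
  rw [if_neg (hcon e he), if_pos rfl] at this
  simp [he] at this

/-- The support of a nonzero real cycle, oriented by its signs, contains a directed closed path
without repeated edges. -/
theorem exists_conformal_cycle {x : E(G) → ℝ} (hx : x ∈ H1 G ℝ) (h0 : x ≠ 0) :
    ∃ (u : V(G)) (n : ℕ) (c : E(G) → ℤ), IsWalk G u u n c ∧ 0 < n ∧ size c = n ∧
      ∀ e, c e = 0 ∨ (x e ≠ 0 ∧ c e = SignType.sign (x e)) := by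
  classical
  obtain ⟨e₀, he₀⟩ := Function.ne_iff.mp h0
  choose! next hnext htail using fun (e : E(G)) (he : x e ≠ 0) => exists_next hx he
  -- following the flow from any edge ends up in a periodic sequence of edges
  obtain ⟨e₁, he₁, hper⟩ : ∃ e, x e ≠ 0 ∧ e ∈ Function.periodicPts next := by
    have hit (k : ℕ) : x (next^[k] e₀) ≠ 0 := by
      induction k with
      | zero => exact he₀
      | succ k ih =>
        rw [Function.iterate_succ_apply']
        exact hnext _ ih
    obtain ⟨i, j, hij, h⟩ := Finite.exists_ne_map_eq_of_infinite (fun k : ℕ => next^[k] e₀)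
    wlog hlt : i < j generalizing i j
    · exact this j i hij.symm h.symm (lt_of_le_of_ne (not_lt.mp hlt) hij.symm)
    refine ⟨next^[i] e₀, hit i, j - i, by omega, ?_⟩
    change next^[j - i] (next^[i] e₀) = _
    rw [← Function.iterate_add_apply, Nat.sub_add_cancel hlt.le]
    exact h.symm
  have hit (k : ℕ) : x (next^[k] e₁) ≠ 0 := by
    induction k with
    | zero => exact he₁
    | succ k ih =>
      rw [Function.iterate_succ_apply']
      exact hnext _ ih
  have hwalk (k : ℕ) : IsWalk G (tail x e₁) (tail x (next^[k] e₁)) k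
      (∑ i ∈ Finset.range k, Pi.single (next^[i] e₁) (SignType.sign (x (next^[i] e₁)) : ℤ)) := by
    induction k with
    | zero => exact IsWalk.nil _
    | succ k ih =>
      rw [Finset.sum_range_succ, Function.iterate_succ_apply', htail _ (hit k)]
      exact ih.step (hit k)
  set p := Function.minimalPeriod next e₁ with hp
  have hppos : 0 < p := Function.minimalPeriod_pos_of_mem_periodicPts hper
  set c : E(G) → ℤ := ∑ i ∈ Finset.range p, Pi.single (next^[i] e₁)
    (SignType.sign (x (next^[i] e₁)) : ℤ) with hc
  have hw : IsWalk G (tail x e₁) (tail x e₁) p c := by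
    have := hwalk p
    rwa [hp, Function.iterate_minimalPeriod, ← hp] at this
  have hce (e : E(G)) :
      c e = 0 ∨ ∃ i ∈ Finset.range p, next^[i] e₁ = e ∧ c e = SignType.sign (x e) := by
    by_cases h : ∃ i ∈ Finset.range p, next^[i] e₁ = e
    · obtain ⟨i, hi, rfl⟩ := h
      refine Or.inr ⟨i, hi, rfl, ?_⟩
      rw [hc, Finset.sum_apply, Finset.sum_eq_single i]
      · rw [Pi.single_eq_same]
      · intro j hj hji
        refine Pi.single_eq_of_ne (fun heq => hji ?_) _
        exact Function.iterate_injOn_Iio_minimalPeriod (Finset.mem_range.mp hj)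
          (Finset.mem_range.mp hi) heq.symm
      · exact fun h => absurd hi h
    · push Not at h
      left
      rw [hc, Finset.sum_apply]
      exact Finset.sum_eq_zero fun i hi => Pi.single_eq_of_ne (h i hi).symm _
  refine ⟨tail x e₁, p, c, hw, hppos, le_antisymm hw.size_le ?_, fun e => ?_⟩
  · -- every step of the path contributes `1` to the pairing of `c` with the sign vector of `x`
    have hsum : (p : ℤ) = ∑ e, c e * SignType.sign (x e) := by
      have : ∑ e, c e * (SignType.sign (x e) : ℤ) = ∑ i ∈ Finset.range p, (1 : ℤ) := by
        simp only [hc, Finset.sum_apply, Finset.sum_mul]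
        rw [Finset.sum_comm]
        refine Finset.sum_congr rfl fun i _ => ?_
        rw [Finset.sum_eq_single (next^[i] e₁)]
        · rw [Pi.single_eq_same]
          rcases lt_or_gt_of_ne (hit i) with h | h <;> simp [h]
        · intro e _ he
          rw [Pi.single_eq_of_ne he, zero_mul]
        · simp
      rw [this]
      simp
    have hle : (p : ℤ) ≤ (size c : ℤ) := by
      rw [hsum, size, Nat.cast_sum]
      refine Finset.sum_le_sum fun e _ => ?_
      rw [Int.natCast_natAbs]
      refine (le_abs_self _).trans ?_
      rw [abs_mul]
      refine mul_le_of_le_one_right (abs_nonneg _) ?_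
      rcases SignType.sign (x e) with _ | _ | _ <;> simp
    exact_mod_cast hle
  · rcases hce e with h | ⟨i, hi, rfl, h⟩
    · exact Or.inl h
    · exact Or.inr ⟨hit i, h⟩

/-! ### The stable norm is the `ℓ¹` norm -/

theorem sign_intCast_real (n : ℤ) : SignType.sign (n : ℝ) = SignType.sign n := by
  rcases lt_trichotomy n 0 with h | rfl | h
  · rw [sign_neg h, sign_neg (by exact_mod_cast h)]
  · simp
  · rw [sign_pos h, sign_pos (by exact_mod_cast h)]

/-- An integral cycle contains a directed closed path without repeated edges, whose signs agree with
those of the cycle. -/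
theorem exists_conformal_cycle_int {θ : E(G) → ℤ} (hθ : θ ∈ H1 G ℤ) (h0 : θ ≠ 0) :
    ∃ (u : V(G)) (n : ℕ) (c : E(G) → ℤ), IsWalk G u u n c ∧ 0 < n ∧ size c = n ∧
      ∀ e, c e = 0 ∨ (θ e ≠ 0 ∧ c e = SignType.sign (θ e)) := by
  obtain ⟨u, n, c, hw, hn, hs, hc⟩ := exists_conformal_cycle (intCast_mem_H1 G ⟨θ, hθ⟩) (by
    contrapose! h0
    ext e
    have h1 : ((θ e : ℤ) : ℝ) = 0 := congrFun h0 e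
    exact_mod_cast h1)
  refine ⟨u, n, c, hw, hn, hs, fun e => ?_⟩
  simpa [sign_intCast_real] using hc e

/-- The `ℓ¹` norm is additive under conformal decompositions. -/
theorem size_sub_add_size {ι : Type*} [Fintype ι] {θ c : ι → ℤ}
    (h : ∀ e, c e = 0 ∨ (θ e ≠ 0 ∧ c e = SignType.sign (θ e))) :
    size (θ - c) + size c = size θ := by
  rw [size, size, size, ← Finset.sum_add_distrib]
  refine Finset.sum_congr rfl fun e _ => ?_
  rcases h e with h | ⟨h0, h⟩
  · simp [h]
  · rcases lt_or_gt_of_ne h0 with h1 | h1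
    · rw [sign_neg h1, SignType.coe_neg_one] at h
      rw [Pi.sub_apply]
      omega
    · rw [sign_pos h1, SignType.coe_one] at h
      rw [Pi.sub_apply]
      omega

/-- The classes `n θ` have closed walks of length `n |θ|₁ + O(1)`: `θ` is a conformal sum of closed
walks, each of which can be repeated `n` times, and the connecting paths do not depend on `n`. -/
theorem exists_isWalk_nsmul (hG : Connected G) {θ : E(G) → ℤ} (hθ : θ ∈ H1 G ℤ) (v : V(G)) :
    ∃ K, ∀ n : ℕ, ∃ k ≤ n * size θ + K, IsWalk G v v k (n • θ) := by
  induction hs : size θ using Nat.strong_induction_on generalizing θ with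
  | _ s ih =>
    by_cases h0 : θ = 0
    · subst h0
      exact ⟨0, fun n => ⟨0, Nat.zero_le _, by simpa using IsWalk.nil v⟩⟩
    · obtain ⟨u, p, c, hw, hp, hsc, hc⟩ := exists_conformal_cycle_int hθ h0
      have hadd := size_sub_add_size hc
      obtain ⟨K, hK⟩ := ih (size (θ - c)) (by omega) (sub_mem hθ hw.mem_H1) rfl
      obtain ⟨d, q, hq⟩ := exists_isWalk hG v u
      refine ⟨K + (d + d), fun n => ?_⟩
      obtain ⟨k, hk, hkw⟩ := hK n
      refine ⟨k + (d + n * p + d), ?_, ?_⟩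
      · rw [← hs, ← hadd, hsc, mul_add]
        omega
      · convert hkw.append ((hq.append (hw.repeat n)).append hq.reverse) using 1
        rw [smul_sub]
        abel

theorem size_le_minLength (hG : Connected G) (θ : H1 G ℤ) : size θ.1 ≤ minLength G θ := by
  obtain ⟨v, hv⟩ := hG.1
  obtain ⟨K, hK⟩ := exists_isWalk_nsmul hG θ.2 ⟨v, hv⟩
  obtain ⟨k, -, hk⟩ := hK 1
  rw [one_smul] at hk
  have hne : {n : ℕ | ∃ u : V(G), IsWalk G u u n θ}.Nonempty := ⟨k, ⟨v, hv⟩, hk⟩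
  have ⟨u, hu⟩ : ∃ u : V(G), IsWalk G u u (minLength G θ) θ := Nat.sInf_mem hne
  exact hu.size_le

theorem exists_minLength_le (hG : Connected G) (θ : H1 G ℤ) :
    ∃ K, ∀ n : ℕ, minLength G (n • θ) ≤ n * size θ.1 + K := by
  obtain ⟨v, hv⟩ := hG.1
  obtain ⟨K, hK⟩ := exists_isWalk_nsmul hG θ.2 ⟨v, hv⟩
  refine ⟨K, fun n => ?_⟩
  obtain ⟨k, hk, hkw⟩ := hK n
  have hmem : k ∈ {k : ℕ | ∃ u : V(G), IsWalk G u u k (n • θ : H1 G ℤ)} := ⟨⟨v, hv⟩, hkw⟩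
  exact (Nat.sInf_le hmem).trans hk

theorem stableNormInt_eq (hG : Connected G) (θ : H1 G ℤ) : stableNormInt G θ = size θ.1 := by
  obtain ⟨K, hK⟩ := exists_minLength_le hG θ
  refine Tendsto.limUnder_eq ?_
  have hup : Tendsto (fun n : ℕ => (size θ.1 : ℝ) + (K : ℝ) / n) atTop (𝓝 (size θ.1)) := by
    simpa using tendsto_const_nhds.add (tendsto_const_div_atTop_nhds_zero_nat (K : ℝ))
  refine tendsto_of_tendsto_of_tendsto_of_le_of_le' tendsto_const_nhds hup ?_ ?_
  · filter_upwards [eventually_gt_atTop 0] with n hn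
    rw [le_div_iff₀ (by exact_mod_cast hn), mul_comm]
    have := size_le_minLength hG (n • θ)
    rw [show (n • θ : H1 G ℤ).1 = n • θ.1 from rfl, size_nsmul] at this
    exact_mod_cast this
  · filter_upwards [eventually_gt_atTop 0] with n hn
    have hn' : (0 : ℝ) < n := by exact_mod_cast hn
    rw [div_le_iff₀ hn', add_mul, div_mul_cancel₀ _ hn'.ne', mul_comm]
    exact_mod_cast hK n

/-- Integral cycles span the real ones: subtract multiples of directed closed paths in the support,
until nothing is left. -/
theorem span_lattice : Submodule.span ℝ (lattice G : Set (H1 G ℝ)) = ⊤ := by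
  classical
  rw [eq_top_iff]
  rintro ⟨x, hx⟩ -
  induction hs : (Finset.univ.filter fun e => x e ≠ 0).card using Nat.strong_induction_on
    generalizing x with
  | _ s ih =>
    by_cases h0 : x = 0
    · subst h0
      exact zero_mem _
    obtain ⟨u, n, c, hw, hn, hsc, hc⟩ := exists_conformal_cycle hx h0
    obtain ⟨e₀, he₀⟩ : ∃ e, c e ≠ 0 := by
      by_contra! hcon
      rw [size_eq_zero.mpr (funext hcon)] at hsc
      omega
    have hce₀ := (hc e₀).resolve_left he₀
    set y : H1 G ℝ := toReal G ⟨c, hw.mem_H1⟩ with hy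
    have hye (e : E(G)) : y.1 e = c e := rfl
    have hz := (⟨x, hx⟩ - |x e₀| • y : H1 G ℝ).2
    have hze (e : E(G)) : (⟨x, hx⟩ - |x e₀| • y : H1 G ℝ).1 e = x e - |x e₀| * c e := by
      simp [hye]
    have := ih _ ?_ _ hz rfl
    · have h2 : y ∈ Submodule.span ℝ (lattice G : Set (H1 G ℝ)) :=
        Submodule.subset_span ⟨_, rfl⟩
      have h3 := add_mem this (Submodule.smul_mem _ |x e₀| h2)
      rwa [Subtype.coe_eta, sub_add_cancel] at h3
    · rw [← hs]
      refine Finset.card_lt_card ⟨fun e => ?_, fun hsub => ?_⟩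
      · simp only [Finset.mem_filter, Finset.mem_univ, true_and, hze]
        intro h hxe
        rcases hc e with h1 | h1
        · simp [h1, hxe] at h
        · exact h1.1 hxe
      · have := @hsub e₀ (by simpa using hce₀.1)
        simp only [Finset.mem_filter, Finset.mem_univ, true_and, hze] at this
        apply this
        rw [hce₀.2, SignType.intCast_cast, mul_comm, sign_mul_abs, sub_self]

/-- Distinct integral cycles differ by at least `1` in some coordinate. -/
instance : DiscreteTopology (lattice G) := by
  refine DiscreteTopology.of_forall_le_dist one_pos ?_
  rintro ⟨_, a, rfl⟩ ⟨_, b, rfl⟩ hab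
  have : a.1 ≠ b.1 := fun h => hab (by rw [Subtype.ext h])
  obtain ⟨e, he⟩ := Function.ne_iff.mp this
  have h1 : (1 : ℝ) ≤ dist (a.1 e : ℝ) (b.1 e) := by
    rw [Real.dist_eq]
    exact_mod_cast Int.one_le_abs (sub_ne_zero.mpr he)
  exact h1.trans (dist_le_pi_dist (fun e => (a.1 e : ℝ)) (fun e => (b.1 e : ℝ)) e)

instance : IsZLattice ℝ (lattice G) := ⟨span_lattice⟩

theorem continuous_l1 {ι : Type*} [Fintype ι] : Continuous (l1 : (ι → ℝ) → ℝ) := by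
  unfold l1
  fun_prop

theorem l1_smul {ι : Type*} [Fintype ι] (a : ℝ) (x : ι → ℝ) : l1 (a • x) = |a| * l1 x := by
  simp [l1, abs_mul, Finset.mul_sum]

theorem l1_toReal (θ : H1 G ℤ) : l1 (toReal G θ).1 = size θ.1 := l1_intCast θ.1

theorem toReal_injective : Function.Injective (toReal G) := by
  intro a b h
  ext e
  have h1 : ((a.1 e : ℤ) : ℝ) = b.1 e := congrFun (congrArg Subtype.val h) e
  exact_mod_cast h1

theorem tendsto_intFloor_mul_div (a : ℝ) :
    Tendsto (fun n : ℕ => (⌊a * n⌋ : ℝ) / n) atTop (𝓝 a) := by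
  have hlow : Tendsto (fun n : ℕ => a - 1 / (n : ℝ)) atTop (𝓝 a) := by
    simpa using tendsto_const_nhds.sub (tendsto_const_div_atTop_nhds_zero_nat (1 : ℝ))
  refine tendsto_of_tendsto_of_tendsto_of_le_of_le' hlow tendsto_const_nhds ?_ ?_
  all_goals
    filter_upwards [eventually_gt_atTop 0] with n hn
    have hn' : (0 : ℝ) < n := by exact_mod_cast hn
  · rw [le_div_iff₀ hn', sub_mul, div_mul_cancel₀ _ hn'.ne']
    exact (Int.sub_one_lt_floor _).le
  · rw [div_le_iff₀ hn']
    exact Int.floor_le _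

/-- Rational classes are dense. -/
theorem denseRange_rational :
    DenseRange fun p : ℕ+ × H1 G ℤ => ((p.1 : ℕ) : ℝ)⁻¹ • toReal G p.2 := by
  intro x
  -- with respect to an integral basis, round the coordinates of `n x` down and divide by `n`
  have := ZLattice.module_free ℝ (lattice G)
  have := ZLattice.module_finite ℝ (lattice G)
  let B := (Module.Free.chooseBasis ℤ (lattice G)).ofZLatticeBasis ℝ (lattice G)
  have hB (i) : ∃ θ, toReal G θ = B i := by
    rw [Module.Basis.ofZLatticeBasis_apply]
    exact (Module.Free.chooseBasis ℤ (lattice G) i).2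
  choose θ hθ using hB
  refine mem_closure_of_tendsto (b := atTop) (f := fun n : ℕ =>
    (((n.succPNat : ℕ) : ℝ)⁻¹ • toReal G (∑ i, ⌊(n.succPNat : ℕ) * B.repr x i⌋ • θ i)))
    ?_ (Eventually.of_forall fun n => ⟨(n.succPNat, _), rfl⟩)
  have h (n : ℕ) : (((n.succPNat : ℕ) : ℝ)⁻¹ •
        toReal G (∑ i, ⌊(n.succPNat : ℕ) * B.repr x i⌋ • θ i)) =
      ∑ i, ((⌊B.repr x i * ((n + 1 : ℕ) : ℝ)⌋ : ℝ) / ((n + 1 : ℕ) : ℝ)) • B i := by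
    rw [map_sum, Finset.smul_sum]
    refine Finset.sum_congr rfl fun i _ => ?_
    rw [map_smul, hθ, ← Int.cast_smul_eq_zsmul ℝ, smul_smul, Nat.succPNat_coe, mul_comm (B.repr x i),
      div_eq_inv_mul, Nat.succ_eq_add_one]
  simp only [h]
  nth_rewrite 2 [← B.sum_repr x]
  refine tendsto_finsetSum _ fun i _ => Tendsto.smul_const ?_ _
  exact (tendsto_intFloor_mul_div _).comp (tendsto_add_atTop_nat 1)

theorem stableNorm_eq (hG : Connected G) (x : H1 G ℝ) : stableNorm G x = l1 x.1 := by
  have hne : (comap (fun p : ℕ+ × H1 G ℤ => ((p.1 : ℕ) : ℝ)⁻¹ • toReal G p.2) (𝓝 x)).NeBot :=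
    comap_neBot_iff.mpr fun t ht => by
      obtain ⟨_, hy, p, rfl⟩ := mem_closure_iff_nhds.mp (denseRange_rational x) t ht
      exact ⟨p, hy⟩
  refine Tendsto.limUnder_eq ?_
  have hc : Tendsto (fun y : H1 G ℝ => l1 y.1) (𝓝 x) (𝓝 (l1 x.1)) :=
    (continuous_l1.comp continuous_subtype_val).tendsto x
  refine (hc.comp tendsto_comap).congr fun p => ?_
  rw [Function.comp_apply, Submodule.coe_smul, l1_smul, l1_toReal, stableNormInt_eq hG,
    abs_of_nonneg (by positivity)]

end graph

/-! ### Counting integral cycles asymptotically -/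

section covolume

variable {E : Type*} [NormedAddCommGroup E] [NormedSpace ℝ E] [FiniteDimensional ℝ E]
  [MeasurableSpace E] [BorelSpace E] (L : Submodule ℤ E) [DiscreteTopology L] [IsZLattice ℝ L]
  (μ : Measure E) [μ.IsAddHaarMeasure]

/-- In the coordinates of a lattice basis, Lebesgue measure is any Haar measure divided by the
covolume of the lattice. -/
theorem volume_real_image_equivFun {ι : Type*} [Fintype ι] (b : Module.Basis ι ℤ L) (s : Set E) :
    volume.real ((b.ofZLatticeBasis ℝ L).equivFun '' s) =
      (ZLattice.covolume L μ)⁻¹ * μ.real s := by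
  set B := b.ofZLatticeBasis ℝ L with hB
  have h1 : B.addHaar.map B.equivFunL = volume := by
    have hmap : B.map B.equivFunL.toLinearEquiv = Pi.basisFun ℝ ι := by
      classical
      ext i j
      simp [Finsupp.single_apply, Pi.single_apply, eq_comm]
    rw [Module.Basis.map_addHaar, hmap, Module.Basis.addHaar, Module.Basis.parallelepiped_basisFun,
      addHaarMeasure_eq_volume_pi]
  have h2 : volume (B.equivFun '' s) = B.addHaar s := by
    have hpre : B.equivFunL ⁻¹' (B.equivFun '' s) = s := B.equivFun.injective.preimage_image s
    rw [← h1]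
    exact (B.equivFunL.toHomeomorph.measurableEmbedding.map_apply _ _).trans (congrArg _ hpre)
  have h3 : μ s = μ (parallelepiped B) * B.addHaar s := by
    have := Measure.addHaarMeasure_unique μ B.parallelepiped
    rw [Module.Basis.addHaar]
    nth_rewrite 1 [this]
    simp
  have h4 : ZLattice.covolume L μ = μ.real (parallelepiped B) := by
    rw [ZLattice.covolume_eq_measure_fundamentalDomain L μ (ZLattice.isAddFundamentalDomain b μ)]
    exact measureReal_congr (ZSpan.fundamentalDomain_ae_parallelepiped B μ)
  rw [measureReal_def, measureReal_def, h2, h3, ENNReal.toReal_mul, h4, ← measureReal_def,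
    ← measureReal_def, inv_mul_cancel_left₀]
  rw [← h4]
  exact ZLattice.covolume_ne_zero L μ

end covolume

section graph

variable {α β : Type*} {G : Graph α β} [Fintype E(G)]

theorem l1_add_le {ι : Type*} [Fintype ι] (x y : ι → ℝ) : l1 (x + y) ≤ l1 x + l1 y := by
  rw [l1, l1, l1, ← Finset.sum_add_distrib]
  exact Finset.sum_le_sum fun e _ => abs_add_le _ _

theorem convex_l1_ball : Convex ℝ {x : H1 G ℝ | l1 x.1 ≤ 1} := by
  intro x hx y hy a b ha hb hab
  have h := l1_add_le (a • x.1) (b • y.1)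
  rw [l1_smul, l1_smul, abs_of_nonneg ha, abs_of_nonneg hb] at h
  have h1 := mul_le_mul_of_nonneg_left (show l1 x.1 ≤ 1 from hx) ha
  have h2 := mul_le_mul_of_nonneg_left (show l1 y.1 ≤ 1 from hy) hb
  change l1 (a • x.1 + b • y.1) ≤ 1
  linarith

theorem abs_le_l1 {ι : Type*} [Fintype ι] (x : ι → ℝ) (e : ι) : |x e| ≤ l1 x :=
  Finset.single_le_sum (f := fun e => |x e|) (fun _ _ => abs_nonneg _) (Finset.mem_univ e)

theorem isClosed_l1_ball : IsClosed {x : H1 G ℝ | l1 x.1 ≤ 1} :=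
  isClosed_le (continuous_l1.comp continuous_subtype_val) continuous_const

theorem isBounded_l1_ball : Bornology.IsBounded {x : H1 G ℝ | l1 x.1 ≤ 1} := by
  refine (Metric.isBounded_closedBall (x := (0 : H1 G ℝ)) (r := 1)).subset fun x hx => ?_
  rw [mem_closedBall_zero_iff]
  change ‖x.1‖ ≤ 1
  rw [pi_norm_le_iff_of_nonneg zero_le_one]
  exact fun e => (abs_le_l1 x.1 e).trans hx

theorem ballVolume_eq (hG : Connected G) :
    ballVolume G = (ZLattice.covolume (lattice G) Measure.addHaar)⁻¹ *
      (Measure.addHaar : Measure (H1 G ℝ)).real {x : H1 G ℝ | l1 x.1 ≤ 1} := by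
  have h := ZLattice.covolume_pos (lattice G) (Measure.addHaar : Measure (H1 G ℝ))
  simp only [ballVolume, stableNorm_eq hG, normalizedHaar, Measure.smul_apply, smul_eq_mul,
    ENNReal.toReal_mul, ENNReal.toReal_ofReal (inv_nonneg.mpr h.le), measureReal_def]

theorem ballVolume_pos (hG : Connected G) : 0 < ballVolume G := by
  rw [ballVolume_eq hG]
  refine mul_pos (inv_pos.mpr (ZLattice.covolume_pos _ _)) (ENNReal.toReal_pos ?_ ?_)
  · refine (Measure.measure_pos_of_mem_nhds _ (x := 0) (mem_nhds_iff.mpr ⟨{x : H1 G ℝ | l1 x.1 < 1}, fun x (hx : l1 x.1 < 1) => hx.le,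
      isOpen_lt (continuous_l1.comp continuous_subtype_val) continuous_const, ?_⟩)).ne'
    simp [l1]
  · exact isBounded_l1_ball.measure_lt_top.ne

open scoped Pointwise in
theorem ncard_lattice_ball {n : ℕ} (hn : 0 < n) :
    Nat.card ({x : H1 G ℝ | l1 x.1 ≤ 1} ∩ (n : ℝ)⁻¹ • (lattice G : Set (H1 G ℝ)) : Set (H1 G ℝ)) =
      {θ : H1 G ℤ | size θ.1 ≤ n}.ncard := by
  have hn' : (0 : ℝ) < n := by exact_mod_cast hn
  have : ({x : H1 G ℝ | l1 x.1 ≤ 1} ∩ (n : ℝ)⁻¹ • (lattice G : Set (H1 G ℝ)) : Set (H1 G ℝ)) =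
      (fun θ => (n : ℝ)⁻¹ • toReal G θ) '' {θ : H1 G ℤ | size θ.1 ≤ n} := by
    have key (θ : H1 G ℤ) : l1 ((n : ℝ)⁻¹ • toReal G θ : H1 G ℝ).1 ≤ 1 ↔ size θ.1 ≤ n := by
      rw [Submodule.coe_smul, l1_smul, l1_toReal, abs_of_pos (inv_pos.mpr hn'),
        inv_mul_le_one₀ hn', Nat.cast_le]
    ext x
    constructor
    · rintro ⟨h1, y, ⟨θ, rfl⟩, rfl⟩
      exact ⟨θ, (key θ).mp h1, rfl⟩
    · rintro ⟨θ, hθ, rfl⟩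
      exact ⟨(key θ).mpr hθ, Set.smul_mem_smul_set ⟨θ, rfl⟩⟩
  rw [this, Nat.card_coe_set_eq, Set.ncard_image_of_injective]
  exact (smul_right_injective _ (inv_ne_zero hn'.ne')).comp toReal_injective

/-- The unit ball is convex, so its frontier is a null set and lattice points in its dilates are
counted by its volume. -/
theorem tendsto_ncard_div (hG : Connected G) :
    Tendsto (fun n : ℕ => ({θ : H1 G ℤ | size θ.1 ≤ n}.ncard : ℝ) / (n : ℝ) ^ betti G) atTop
      (𝓝 (ballVolume G)) := by
  have := ZLattice.module_free ℝ (lattice G)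
  have := ZLattice.module_finite ℝ (lattice G)
  have h := ZLattice.covolume.tendsto_card_div_pow'' (Module.Free.chooseBasis ℤ (lattice G))
    (s := {x : H1 G ℝ | l1 x.1 ≤ 1}) isBounded_l1_ball isClosed_l1_ball.measurableSet
    ((convex_l1_ball.linear_image
      ((Module.Free.chooseBasis ℤ (lattice G)).ofZLatticeBasis ℝ _).equivFun.toLinearMap
      ).addHaar_frontier _)
  rw [volume_real_image_equivFun (lattice G) Measure.addHaar, ← ballVolume_eq hG,
    ← Module.finrank_eq_card_basis ((Module.Free.chooseBasis ℤ (lattice G)).ofZLatticeBasis ℝ _)]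
    at h
  refine h.congr' ?_
  filter_upwards [eventually_gt_atTop 0] with n hn
  rw [ncard_lattice_ball hn, betti]

end graph

/-! ### Iterated differences and the number of integral cycles of given size -/

section differences

/-- The iterated difference of order `d` and step `m` of `f` vanishes at all positive integers. -/
def DiffVanishes (m d : ℕ) (f : ℕ → ℤ) : Prop := ∀ n, 0 < n → (fwdDiff m)^[d] f n = 0

variable {m d : ℕ} {f g : ℕ → ℤ}

theorem fwdDiff_iter_congr (h : ∀ n, 0 < n → f n = g n) (d : ℕ) {n : ℕ} (hn : 0 < n) :
    (fwdDiff m)^[d] f n = (fwdDiff m)^[d] g n := by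
  rw [fwdDiff_iter_eq_sum_shift, fwdDiff_iter_eq_sum_shift]
  exact Finset.sum_congr rfl fun k _ => by rw [h _ (by omega)]

theorem DiffVanishes.of_eq_zero (h : ∀ n, 0 < n → f n = 0) : DiffVanishes m d f := fun n hn => by
  rw [fwdDiff_iter_eq_sum_shift]
  exact Finset.sum_eq_zero fun k _ => by rw [h _ (by omega), smul_zero]

theorem DiffVanishes.mono (h : DiffVanishes m d f) {d' : ℕ} (hd : d ≤ d') :
    DiffVanishes m d' f := by
  induction d', hd using Nat.le_induction with
  | base => exact h
  | succ k _ ih =>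
    intro n hn
    rw [Function.iterate_succ_apply', fwdDiff, ih n hn, ih (n + m) (by omega), sub_zero]

theorem DiffVanishes.sum {ι : Type*} {s : Finset ι} {f : ι → ℕ → ℤ}
    (h : ∀ i ∈ s, DiffVanishes m d (f i)) : DiffVanishes m d (∑ i ∈ s, f i) := fun n hn => by
  rw [fwdDiff_iter_finsetSum, Finset.sum_apply]
  exact Finset.sum_eq_zero fun i hi => h i hi n hn

/-- Summation along a step `L` dividing `m` raises the order by one. -/
theorem DiffVanishes.of_step {L : ℕ} (hL : L ∣ m) (h : ∀ n, 0 < n → f (n + L) = f n + g n)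
    (hg : DiffVanishes m d g) : DiffVanishes m (d + 1) f := by
  obtain ⟨q, rfl⟩ := hL
  intro n hn
  have h1 (n : ℕ) (hn : 0 < n) :
      fwdDiff (L * q) f n = (∑ i ∈ Finset.range q, fun k => g (k + i * L)) n := by
    clear hg
    rw [Finset.sum_apply, fwdDiff]
    induction q with
    | zero => simp
    | succ q ih =>
      rw [Finset.sum_range_succ, ← ih, mul_add, mul_one, ← add_assoc, h _ (by omega),
        mul_comm q L]
      ring
  rw [Function.iterate_succ_apply, fwdDiff_iter_congr h1 d hn, fwdDiff_iter_finsetSum,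
    Finset.sum_apply]
  refine Finset.sum_eq_zero fun i _ => ?_
  rw [fwdDiff_iter_comp_add]
  exact hg _ (by omega)

end differences

section graph

variable {α β : Type*} {G : Graph α β} [Fintype E(G)]

theorem finite_size_le (n : ℕ) : {θ : H1 G ℤ | size θ.1 ≤ n}.Finite := by
  classical
  refine ((Set.finite_Icc (fun _ : E(G) => -(n : ℤ)) (fun _ => (n : ℤ))).preimage
    Subtype.val_injective.injOn).subset fun θ hθ => ?_
  have h (e : E(G)) : (θ.1 e).natAbs ≤ n :=
    (Finset.single_le_sum (f := fun e => (θ.1 e).natAbs) (fun _ _ => Nat.zero_le _)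
      (Finset.mem_univ e)).trans hθ
  exact ⟨fun e => by have := h e; dsimp only; omega, fun e => by have := h e; dsimp only; omega⟩

variable (G) in
/-- The integral cycles of `ℓ¹` norm `n`. -/
noncomputable def sphere (n : ℕ) : Finset (H1 G ℤ) :=
  ((finite_size_le n).subset fun _ h => le_of_eq h :
    {θ : H1 G ℤ | size θ.1 = n}.Finite).toFinset

@[simp]
theorem mem_sphere {n : ℕ} {θ : H1 G ℤ} : θ ∈ sphere G n ↔ size θ.1 = n := by
  simp [sphere]

/-- The signs of the coefficients of an integral cycle. -/
noncomputable def signs (θ : H1 G ℤ) (e : E(G)) : SignType := SignType.sign (θ.1 e)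

/-- The number of integral cycles with signs `σ` and `ℓ¹` norm `n`. -/
noncomputable def signCount (σ : E(G) → SignType) (n : ℕ) : ℤ :=
  ((sphere G n).filter fun θ => signs θ = σ).card

/-- The real cycles supported on the support of `σ`. -/
noncomputable def supportSpace (σ : E(G) → SignType) : Submodule ℝ (H1 G ℝ) where
  carrier := {x | ∀ e, σ e = 0 → x.1 e = 0}
  add_mem' {x y} hx hy e he := by simp [hx e he, hy e he]
  zero_mem' e _ := rfl
  smul_mem' a x hx e he := by simp [hx e he]

theorem toReal_mem_supportSpace {σ : E(G) → SignType} {θ : H1 G ℤ}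
    (h : ∀ e, σ e = 0 → θ.1 e = 0) : toReal G θ ∈ supportSpace σ := fun e he => by
  change ((θ.1 e : ℤ) : ℝ) = 0
  rw [h e he, Int.cast_zero]

open Classical in
/-- The signs that arise from `σ` by deleting edges of the support of `c`. -/
noncomputable def deletions (σ : E(G) → SignType) (c : E(G) → ℤ) : Finset (E(G) → SignType) :=
  Finset.univ.filter fun τ => ∀ e, τ e = σ e ∨ (τ e = 0 ∧ c e ≠ 0)

/-- Subtracting the directed closed path `c` from cycles with signs `σ` is a bijection onto the
cycles whose signs arise from `σ` by deleting edges of `c`. -/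
theorem signCount_add {σ : E(G) → SignType} {c : H1 G ℤ}
    (hc : ∀ e, c.1 e = 0 ∨ (σ e ≠ 0 ∧ c.1 e = σ e)) (n : ℕ) :
    signCount σ (n + size c.1) = ∑ τ ∈ deletions σ c.1, signCount τ n := by
  classical
  have hfib := Finset.card_eq_sum_card_fiberwise
    (s := (sphere G n).filter fun θ => signs θ ∈ deletions σ c.1) (f := signs)
    (t := deletions σ c.1) fun θ hθ => (Finset.mem_filter.mp hθ).2
  have hsum : ∑ τ ∈ deletions σ c.1, signCount τ n =
      ((sphere G n).filter fun θ => signs θ ∈ deletions σ c.1).card := by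
    rw [hfib, Nat.cast_sum]
    refine Finset.sum_congr rfl fun τ hτ => ?_
    rw [signCount, Finset.filter_filter]
    congr 2
    ext θ
    simp only [Finset.mem_filter]
    exact and_congr_right fun _ => ⟨fun h => ⟨h ▸ hτ, h⟩, fun h => h.2⟩
  have hconf {θ : H1 G ℤ} (hθ : signs θ = σ) (e : E(G)) :
      c.1 e = 0 ∨ (θ.1 e ≠ 0 ∧ c.1 e = SignType.sign (θ.1 e)) := by
    have h1 : SignType.sign (θ.1 e) = σ e := congrFun hθ e
    rw [h1]
    refine (hc e).imp_right fun h => ⟨fun h0 => h.1 ?_, h.2⟩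
    rw [← h1, h0, sign_zero]
  have hback {θ : H1 G ℤ} (hθ : signs θ ∈ deletions σ c.1) : signs (θ + c) = σ := by
    ext1 e
    have h1 : SignType.sign (θ.1 e) = σ e ∨ (SignType.sign (θ.1 e) = 0 ∧ c.1 e ≠ 0) :=
      (Finset.mem_filter.mp hθ).2 e
    change SignType.sign (θ.1 e + c.1 e) = σ e
    rcases hc e with h | ⟨h0, h⟩
    · simpa [h] using h1
    · rw [h]
      rcases h1 with h1 | ⟨h1, -⟩
      · rw [← h1] at h0 ⊢
        rcases lt_or_gt_of_ne (sign_ne_zero.mp h0) with h2 | h2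
        · rw [sign_neg h2, SignType.coe_neg_one]
          exact sign_neg (by omega)
        · rw [sign_pos h2, SignType.coe_one]
          exact sign_pos (by omega)
      · rw [sign_eq_zero_iff.mp h1, zero_add]
        rcases hs : σ e with _ | _ | _ <;> rfl
  rw [hsum, signCount, Nat.cast_inj]
  refine Finset.card_nbij' (fun θ => θ - c) (fun θ => θ + c) ?_ ?_ ?_ ?_
  · intro θ hθ
    obtain ⟨h1, h2⟩ := Finset.mem_filter.mp hθ
    rw [mem_sphere] at h1
    have h3 := size_sub_add_size (hconf h2)
    refine Finset.mem_filter.mpr ⟨mem_sphere.mpr (?_ : size (θ.1 - c.1) = n),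
      Finset.mem_filter.mpr ⟨Finset.mem_univ _, fun e => ?_⟩⟩
    · omega
    · rw [← h2]
      change SignType.sign (θ.1 e - c.1 e) = SignType.sign (θ.1 e) ∨
        (SignType.sign (θ.1 e - c.1 e) = 0 ∧ _)
      rcases hconf h2 e with h | ⟨h0, h⟩
      · simp [h]
      · rcases lt_or_gt_of_ne h0 with h4 | h4
        · rw [sign_neg h4, SignType.coe_neg_one] at h
          rw [h]
          rcases eq_or_lt_of_le (show θ.1 e ≤ -1 by omega) with h5 | h5
          · exact Or.inr ⟨by rw [h5]; rfl, by decide⟩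
          · exact Or.inl (by rw [sign_neg h4, sign_neg (by omega)])
        · rw [sign_pos h4, SignType.coe_one] at h
          rw [h]
          rcases eq_or_lt_of_le (show 1 ≤ θ.1 e by omega) with h5 | h5
          · exact Or.inr ⟨by rw [← h5]; rfl, by decide⟩
          · exact Or.inl (by rw [sign_pos h4, sign_pos (by omega)])
  · intro θ hθ
    obtain ⟨h1, h2⟩ := Finset.mem_filter.mp hθ
    rw [mem_sphere] at h1
    have h3 := size_sub_add_size (hconf (hback h2))
    rw [show (θ + c).1 - c.1 = θ.1 by simp] at h3
    exact Finset.mem_filter.mpr ⟨mem_sphere.mpr (by rw [← h3, h1]), hback h2⟩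
  · exact fun θ _ => sub_add_cancel θ c
  · exact fun θ _ => add_sub_cancel_right θ c

theorem supportSpace_lt {σ τ : E(G) → SignType} {c : H1 G ℤ}
    (hc : ∀ e, c.1 e = 0 ∨ (σ e ≠ 0 ∧ c.1 e = σ e)) (hτ : τ ∈ deletions σ c.1) (hne : τ ≠ σ) :
    supportSpace τ < supportSpace σ := by
  have hτ' := (Finset.mem_filter.mp hτ).2
  refine lt_of_le_of_ne (fun x hx e he => hx e ?_) fun heq => ?_
  · rcases hτ' e with h | h
    · rw [h, he]
    · exact h.1
  · obtain ⟨e, he⟩ := Function.ne_iff.mp hne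
    have h := (hτ' e).resolve_left he
    have hmem : toReal G c ∈ supportSpace τ := by
      rw [heq]
      exact toReal_mem_supportSpace fun e he => (hc e).resolve_right fun h => h.1 he
    have h0 : ((c.1 e : ℤ) : ℝ) = 0 := hmem e h.1
    exact h.2 (by exact_mod_cast h0)

/-- Every cone of cycles with given signs contributes a count whose differences vanish, to an order
bounded by the dimension of its span. A nonempty cone contains a directed closed path `c`, and
`signCount_add` expresses the difference of the count with step `size c` through cones whose span
has smaller dimension. -/
theorem diffVanishes_signCount {m : ℕ} (hm : ∀ L, 0 < L → L ≤ Fintype.card E(G) → L ∣ m) (d : ℕ) :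
    ∀ σ : E(G) → SignType, Module.finrank ℝ (supportSpace σ) ≤ d →
      DiffVanishes m d (signCount σ) := by
  induction d with
  | zero =>
    intro σ hσ
    refine DiffVanishes.of_eq_zero fun n hn => ?_
    rw [signCount, Nat.cast_eq_zero, Finset.card_eq_zero, Finset.filter_eq_empty_iff]
    rintro θ hθ rfl
    have hmem : toReal G θ ∈ supportSpace (signs θ) :=
      toReal_mem_supportSpace fun e he => sign_eq_zero_iff.mp he
    rw [Submodule.finrank_eq_zero.mp (Nat.le_zero.mp hσ), Submodule.mem_bot,
      map_eq_zero_iff _ toReal_injective] at hmem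
    rw [mem_sphere, hmem] at hθ
    have h0 : size (0 : E(G) → ℤ) = 0 := size_eq_zero.mpr rfl
    exact hn.ne (h0.symm.trans hθ)
  | succ d ih =>
    classical
    intro σ hσ
    by_cases hex : ∃ θ : H1 G ℤ, θ ≠ 0 ∧ signs θ = σ
    · obtain ⟨θ, h0, rfl⟩ := hex
      obtain ⟨u, L, c, hw, hL, hsc, hc⟩ :=
        exists_conformal_cycle_int θ.2 fun h => h0 (Subtype.ext h)
      have hc' : ∀ e, c e = 0 ∨ (signs θ e ≠ 0 ∧ c e = signs θ e) := fun e =>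
        (hc e).imp_right fun h => ⟨sign_ne_zero.mpr h.1, h.2⟩
      have hLE : L ≤ Fintype.card E(G) := by
        rw [← hsc, ← Finset.card_univ, Finset.card_eq_sum_ones]
        refine Finset.sum_le_sum fun e _ => ?_
        rcases hc e with h | ⟨-, h⟩
        · simp [h]
        · rw [h]
          rcases SignType.sign (θ.1 e) with _ | _ | _ <;> simp
      have hself : signs θ ∈ deletions (signs θ) c :=
        Finset.mem_filter.mpr ⟨Finset.mem_univ _, fun e => Or.inl rfl⟩
      refine DiffVanishes.of_step (hm L hL hLE)
        (g := ∑ τ ∈ (deletions (signs θ) c).erase (signs θ), signCount τ) (fun n _ => ?_) ?_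
      · have := signCount_add (c := ⟨c, hw.mem_H1⟩) hc' n
        rw [hsc] at this
        rw [this, Finset.sum_apply]
        exact (Finset.add_sum_erase _ (fun τ => signCount τ n) hself).symm
      · refine DiffVanishes.sum fun τ hτ => ih τ ?_
        obtain ⟨hne, hτ⟩ := Finset.mem_erase.mp hτ
        have := Submodule.finrank_lt_finrank_of_lt
          (supportSpace_lt (c := ⟨c, hw.mem_H1⟩) hc' hτ hne)
        omega
    · refine DiffVanishes.of_eq_zero fun n hn => ?_
      rw [signCount, Nat.cast_eq_zero, Finset.card_eq_zero, Finset.filter_eq_empty_iff]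
      refine fun θ hθ h => hex ⟨θ, ?_, h⟩
      rintro rfl
      have h0 : size (0 : E(G) → ℤ) = 0 := size_eq_zero.mpr rfl
      exact hn.ne (h0.symm.trans (mem_sphere.mp hθ))

variable (G) in
/-- The number of integral cycles of norm `n` is the sum of the counts over all sign vectors. -/
theorem diffVanishes_card_sphere :
    DiffVanishes (Fintype.card E(G)).factorial (betti G) fun n => (sphere G n).card := by
  classical
  have h : (fun n => ((sphere G n).card : ℤ)) = ∑ σ : E(G) → SignType, signCount σ := by
    ext n
    rw [Finset.card_eq_sum_card_fiberwise (f := signs) (t := Finset.univ) fun _ _ =>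
      Finset.mem_coe.mpr (Finset.mem_univ _), Nat.cast_sum, Finset.sum_apply]
    rfl
  rw [h]
  exact DiffVanishes.sum fun σ _ =>
    diffVanishes_signCount (fun L h0 hL => Nat.dvd_factorial h0 hL) _ σ (Submodule.finrank_le _)

end graph

/-! ### Quasi-polynomials -/

/-- A sequence whose iterated differences of order `b` and step `m` vanish is a quasi-polynomial:
on each residue class modulo `m` this is Newton's interpolation formula. -/
theorem exists_quasiPolynomial {m b : ℕ} [NeZero m] (hb : 0 < b) {f : ℕ → ℤ}
    (hf : DiffVanishes m b f) :
    ∃ q : ℕ → ZMod m → ℚ, ∀ n : ℕ, 0 < n →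
      (f n : ℚ) = ∑ l ∈ Finset.range b, q l (n : ZMod m) * (n : ℚ) ^ l := by
  -- every positive integer is `k + i * m` with `1 ≤ k ≤ m`, so all evaluation points are positive
  have newton (k : ℕ) (hk : 0 < k) (i : ℕ) :
      f (k + i * m) = ∑ j ∈ Finset.range b, (i.choose j : ℤ) * (fwdDiff m)^[j] f k := by
    have h := shift_eq_sum_fwdDiff_iter m f i k
    rw [smul_eq_mul] at h
    rw [h, Finset.sum_subset (Finset.range_mono (le_max_left (i + 1) b)),
      ← Finset.sum_subset (Finset.range_mono (le_max_right (i + 1) b))]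
    rotate_left
    · intro j _ hj
      rw [Finset.mem_range, not_lt] at hj
      rw [hf.mono hj k hk, smul_zero]
    · intro j _ hj
      rw [Finset.mem_range, not_lt] at hj
      rw [Nat.choose_eq_zero_of_lt (by omega), zero_smul]
    · exact Finset.sum_congr rfl fun j _ => nsmul_eq_mul _ _
  let P (a : ZMod m) : Polynomial ℚ := ∑ j ∈ Finset.range b,
    Polynomial.C ((((fwdDiff m)^[j] f ((a - 1).val + 1) : ℤ) : ℚ) / (j.factorial : ℚ)) *
      (descPochhammer ℚ j).comp
        ((Polynomial.X - Polynomial.C ((a - 1).val + 1 : ℚ)) * Polynomial.C (m : ℚ)⁻¹)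
  refine ⟨fun l a => (P a).coeff l, fun n hn => ?_⟩
  have hdeg (a : ZMod m) : (P a).natDegree < b := by
    refine lt_of_le_of_lt (Polynomial.natDegree_sum_le_of_forall_le (n := b - 1) _ _ ?_) (by omega)
    intro j hj
    rw [Finset.mem_range] at hj
    refine (Polynomial.natDegree_C_mul_le _ _).trans (Polynomial.natDegree_comp_le.trans ?_)
    rw [descPochhammer_natDegree]
    refine (Nat.mul_le_mul_left j (?_ : _ ≤ 1)).trans (by omega)
    refine (Polynomial.natDegree_mul_C_le _ _).trans ?_
    rw [Polynomial.natDegree_X_sub_C]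
  rw [← Polynomial.eval_eq_sum_range' (hdeg _)]
  obtain ⟨n, rfl⟩ := Nat.exists_eq_succ_of_ne_zero hn.ne'
  have hval : (((n.succ : ℕ) : ZMod m) - 1).val = n % m := by
    rw [Nat.succ_eq_add_one, Nat.cast_add, Nat.cast_one, add_sub_cancel_right, ZMod.val_natCast]
  have hn' : n.succ = (n % m + 1) + (n / m) * m := by
    have := Nat.mod_add_div' n m
    omega
  have hm : (m : ℚ) ≠ 0 := Nat.cast_ne_zero.mpr (NeZero.ne m)
  simp only [P, hval, Polynomial.eval_finsetSum]
  nth_rewrite 1 [hn']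
  rw [newton _ (Nat.succ_pos _), Int.cast_sum]
  refine Finset.sum_congr rfl fun j _ => ?_
  have harg : ((n.succ : ℕ) - ((n % m : ℕ) + 1 : ℚ)) * (m : ℚ)⁻¹ = ((n / m : ℕ) : ℚ) := by
    rw [mul_inv_eq_iff_eq_mul₀ hm, hn']
    push_cast
    ring
  rw [Polynomial.eval_mul, Polynomial.eval_C, Polynomial.eval_comp, Polynomial.eval_mul,
    Polynomial.eval_sub, Polynomial.eval_X, Polynomial.eval_C, Polynomial.eval_C, harg,
    descPochhammer_eval_eq_descFactorial, Nat.descFactorial_eq_factorial_mul_choose]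
  have hfac : (j.factorial : ℚ) ≠ 0 := Nat.cast_ne_zero.mpr j.factorial_ne_zero
  push_cast
  field_simp

theorem tendsto_succ_pow_sub_div (b : ℕ) :
    Tendsto (fun i : ℕ => (((i : ℝ) + 1) ^ b - (i : ℝ) ^ b) / (i : ℝ) ^ (b - 1)) atTop (𝓝 b) := by
  have h : HasDerivAt (fun x : ℝ => x ^ b) (b : ℝ) 1 := by
    simpa using hasDerivAt_pow b (1 : ℝ)
  have h1 := h.tendsto_slope_zero_right
  have h2 : Tendsto (fun i : ℕ => (i : ℝ)⁻¹) atTop (𝓝[>] 0) :=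
    tendsto_inv_atTop_nhdsGT_zero.comp tendsto_natCast_atTop_atTop
  refine (h1.comp h2).congr' ?_
  filter_upwards [eventually_gt_atTop 0] with i hi
  have hi' : (i : ℝ) ≠ 0 := by exact_mod_cast hi.ne'
  simp only [Function.comp_apply, inv_inv, smul_eq_mul, one_pow]
  rcases b with _ | b
  · simp
  · rw [Nat.add_sub_cancel, eq_div_iff (pow_ne_zero _ hi'),
      show (1 + (i : ℝ)⁻¹) = ((i : ℝ) + 1) / i by field_simp, div_pow]
    field_simp
    ring

/-- The Stolz–Cesàro theorem for sums of sequences of polynomial growth. -/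
theorem tendsto_sum_div_pow {b : ℕ} (hb : 0 < b) {D : ℕ → ℝ} {c : ℝ}
    (hD : Tendsto (fun i : ℕ => D i / (i : ℝ) ^ (b - 1)) atTop (𝓝 c)) :
    Tendsto (fun n : ℕ => (∑ i ∈ Finset.range n, D i) / (n : ℝ) ^ b) atTop (𝓝 (c / b)) := by
  have hb' : (b : ℝ) ≠ 0 := by exact_mod_cast hb.ne'
  -- compare with the differences of `n ^ b`, whose sums telescope
  set g : ℕ → ℝ := fun i => ((i : ℝ) + 1) ^ b - (i : ℝ) ^ b with hg
  have hgpos (i : ℕ) : 0 < g i := by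
    rw [hg, sub_pos]
    exact pow_lt_pow_left₀ (by linarith) (by positivity) hb.ne'
  have hgsum (n : ℕ) : ∑ i ∈ Finset.range n, g i = (n : ℝ) ^ b := by
    have := Finset.sum_range_sub (fun i : ℕ => (i : ℝ) ^ b) n
    rw [Nat.cast_zero, zero_pow hb.ne', sub_zero] at this
    rw [← this]
    simp [hg]
  have hlim : Tendsto (fun i => D i / g i) atTop (𝓝 (c / b)) := by
    refine (hD.div (tendsto_succ_pow_sub_div b) hb').congr' ?_
    filter_upwards [eventually_gt_atTop 0] with i hi
    have hi' : (i : ℝ) ≠ 0 := by exact_mod_cast hi.ne'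
    exact div_div_div_cancel_right₀ (pow_ne_zero _ hi') _ _
  have hlit : (fun i => D i - c / b * g i) =o[atTop] g := by
    rw [Asymptotics.isLittleO_iff_tendsto fun i h => absurd h (hgpos i).ne']
    have := hlim.sub_const (c / b)
    rw [sub_self] at this
    refine this.congr fun i => ?_
    rw [sub_div, mul_div_cancel_right₀ _ (hgpos i).ne']
  have hsum := hlit.sum_range (fun i => (hgpos i).le) (by
    simp only [hgsum]
    exact (tendsto_pow_atTop hb.ne').comp tendsto_natCast_atTop_atTop)
  simp only [Finset.sum_sub_distrib, ← Finset.mul_sum, hgsum] at hsum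
  have h0 := hsum.tendsto_div_nhds_zero.add_const (c / b)
  rw [zero_add] at h0
  refine h0.congr' ?_
  filter_upwards [eventually_gt_atTop 0] with n hn
  have hn' : (n : ℝ) ^ b ≠ 0 := pow_ne_zero _ (by exact_mod_cast hn.ne')
  rw [sub_div, mul_div_cancel_right₀ _ hn', sub_add_cancel]

/-- The average of the leading coefficients of a quasi-polynomial is determined by the growth of its
sums. -/
theorem sum_leadingCoeff_eq {m b : ℕ} [NeZero m] (hb : 0 < b) {f : ℕ → ℝ} {q : ℕ → ZMod m → ℝ}
    (hf : ∀ n : ℕ, 0 < n → f n = ∑ l ∈ Finset.range b, q l (n : ZMod m) * (n : ℝ) ^ l) {V : ℝ}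
    (hV : Tendsto (fun n : ℕ => (∑ j ∈ Finset.range n, f (j + 1)) / (n : ℝ) ^ b) atTop (𝓝 V)) :
    ∑ a, q (b - 1) a = m * (b * V) := by
  have hm : (m : ℝ) ≠ 0 := Nat.cast_ne_zero.mpr (NeZero.ne m)
  have hb' : (b : ℝ) ≠ 0 := by exact_mod_cast hb.ne'
  -- the sum over a full period, as a function of the number `i` of the period
  set D : ℕ → ℝ := fun i => ∑ k ∈ Finset.range m, f (i * m + k + 1) with hD
  have hsum (n : ℕ) : ∑ i ∈ Finset.range n, D i = ∑ j ∈ Finset.range (n * m), f (j + 1) := by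
    induction n with
    | zero => simp
    | succ n ih => rw [Finset.sum_range_succ, ih, add_mul, one_mul, Finset.sum_range_add]
  have hterm (k l : ℕ) (hl : l < b) :
      Tendsto (fun i : ℕ => ((i * m + k + 1 : ℕ) : ℝ) ^ l / (i : ℝ) ^ (b - 1)) atTop
        (𝓝 ((m : ℝ) ^ l * 0 ^ (b - 1 - l))) := by
    have h1 : Tendsto (fun i : ℕ => (m : ℝ) + (k + 1) / (i : ℝ)) atTop (𝓝 m) := by
      simpa using tendsto_const_nhds.add (tendsto_const_div_atTop_nhds_zero_nat ((k : ℝ) + 1))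
    have h2 : Tendsto (fun i : ℕ => 1 / (i : ℝ)) atTop (𝓝 0) :=
      tendsto_const_div_atTop_nhds_zero_nat 1
    refine ((h1.pow l).mul (h2.pow (b - 1 - l))).congr' ?_
    filter_upwards [eventually_gt_atTop 0] with i hi
    have hi' : (i : ℝ) ≠ 0 := by exact_mod_cast hi.ne'
    rw [show b - 1 = l + (b - 1 - l) by omega, Nat.add_sub_cancel_left, pow_add, div_pow, one_pow,
      show (m : ℝ) + (k + 1) / i = ((i * m + k + 1 : ℕ) : ℝ) / i by push_cast; field_simp; ring,
      div_pow]
    field_simp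
  have hlim : Tendsto (fun i : ℕ => D i / (i : ℝ) ^ (b - 1)) atTop
      (𝓝 (∑ k ∈ Finset.range m, ∑ l ∈ Finset.range b,
        q l ((k + 1 : ℕ) : ZMod m) * ((m : ℝ) ^ l * 0 ^ (b - 1 - l)))) := by
    have hi (i : ℕ) : D i / (i : ℝ) ^ (b - 1) = ∑ k ∈ Finset.range m, ∑ l ∈ Finset.range b,
        q l ((k + 1 : ℕ) : ZMod m) * (((i * m + k + 1 : ℕ) : ℝ) ^ l / (i : ℝ) ^ (b - 1)) := by
      rw [hD, Finset.sum_div]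
      refine Finset.sum_congr rfl fun k _ => ?_
      rw [hf _ (Nat.succ_pos _), Finset.sum_div]
      refine Finset.sum_congr rfl fun l _ => ?_
      rw [mul_div_assoc, show ((i * m + k + 1 : ℕ) : ZMod m) = ((k + 1 : ℕ) : ZMod m) by
        push_cast; simp]
    simp only [hi]
    exact tendsto_finsetSum _ fun k _ => tendsto_finsetSum _ fun l hl =>
      (hterm k l (Finset.mem_range.mp hl)).const_mul _
  have hc : ∑ k ∈ Finset.range m, ∑ l ∈ Finset.range b,
        q l ((k + 1 : ℕ) : ZMod m) * ((m : ℝ) ^ l * 0 ^ (b - 1 - l)) =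
      (m : ℝ) ^ (b - 1) * ∑ a, q (b - 1) a := by
    have h1 (k : ℕ) : ∑ l ∈ Finset.range b,
        q l ((k + 1 : ℕ) : ZMod m) * ((m : ℝ) ^ l * 0 ^ (b - 1 - l)) =
        q (b - 1) ((k + 1 : ℕ) : ZMod m) * (m : ℝ) ^ (b - 1) := by
      rw [Finset.sum_eq_single (b - 1)]
      · simp
      · intro l hl hne
        rw [Finset.mem_range] at hl
        rw [zero_pow (by omega), mul_zero, mul_zero]
      · intro h
        exact absurd (Finset.mem_range.mpr (by omega)) h
    simp only [h1]
    rw [← Finset.sum_mul, mul_comm]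
    congr 1
    have h2 : ∑ k ∈ Finset.range m, q (b - 1) ((k + 1 : ℕ) : ZMod m) =
        ∑ a : ZMod m, q (b - 1) (a + 1) := by
      refine Finset.sum_nbij' (fun k => (k : ZMod m)) (fun a => a.val) ?_ ?_ ?_ ?_ ?_
      · simp
      · exact fun a _ => Finset.mem_range.mpr (ZMod.val_lt a)
      · exact fun k hk => ZMod.val_cast_of_lt (Finset.mem_range.mp hk)
      · exact fun a _ => ZMod.natCast_zmod_val a
      · intro k _
        push_cast
        rfl
    rw [h2]
    exact Equiv.sum_comp (Equiv.addRight (1 : ZMod m)) (q (b - 1))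
  rw [hc] at hlim
  have h1 := tendsto_sum_div_pow hb hlim
  have h2 : Tendsto (fun n : ℕ => (∑ i ∈ Finset.range n, D i) / (n : ℝ) ^ b) atTop
      (𝓝 (V * (m : ℝ) ^ b)) := by
    have h3 : Tendsto (fun n : ℕ => n * m) atTop atTop :=
      tendsto_id.atTop_mul_const' (Nat.pos_of_ne_zero (NeZero.ne m))
    refine ((hV.comp h3).mul_const ((m : ℝ) ^ b)).congr fun n => ?_
    simp only [Function.comp_apply]
    rw [hsum, Nat.cast_mul, mul_pow]
    have : (m : ℝ) ^ b ≠ 0 := pow_ne_zero _ hm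
    field_simp
  have h3 := tendsto_nhds_unique h1 h2
  rw [div_eq_iff hb'] at h3
  have h4 : (m : ℝ) ^ b = (m : ℝ) ^ (b - 1) * m := by
    rw [← pow_succ, Nat.sub_add_cancel hb]
  rw [h4] at h3
  have h5 : (m : ℝ) ^ (b - 1) ≠ 0 := pow_ne_zero _ hm
  apply mul_left_cancel₀ h5
  rw [h3]
  ring

/-! ### Zeta functions of quasi-polynomials -/

/-- If `(z - x) * f z` has a limit at the isolated singularity `x`, the pole is at most simple. -/
theorem meromorphicAt_of_tendsto_sub_mul {f : ℂ → ℂ} {x c : ℂ}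
    (hd : ∀ᶠ z in 𝓝[≠] x, DifferentiableAt ℂ f z)
    (hc : Tendsto (fun z => (z - x) * f z) (𝓝[≠] x) (𝓝 c)) :
    MeromorphicAt f x ∧ -1 ≤ meromorphicOrderAt f x ∧ (c ≠ 0 → meromorphicOrderAt f x = -1) := by
  classical
  set g : ℂ → ℂ := Function.update (fun z => (z - x) * f z) x c with hg
  have hga : AnalyticAt ℂ g x := by
    refine Complex.analyticAt_of_differentiable_on_punctured_nhds_of_continuousAt ?_
      (continuousAt_update_same.mpr hc)
    filter_upwards [hd, self_mem_nhdsWithin] with z hz hzx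
    have h1 : DifferentiableAt ℂ (fun z => (z - x) * f z) z := by fun_prop
    refine h1.congr_of_eventuallyEq ?_
    filter_upwards [isOpen_ne.mem_nhds hzx] with w hw
    exact Function.update_of_ne hw _ _
  have heq : (fun z => (z - x) ^ (-1 : ℤ) * g z) =ᶠ[𝓝[≠] x] f := by
    filter_upwards [self_mem_nhdsWithin] with z hz
    rw [hg, Function.update_of_ne hz, zpow_neg_one, inv_mul_cancel_left₀ (sub_ne_zero.mpr hz)]
  have hpole : MeromorphicAt (fun z : ℂ => (z - x) ^ (-1 : ℤ)) x := by fun_prop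
  have hord : meromorphicOrderAt f x = -1 + meromorphicOrderAt g x := by
    refine (meromorphicOrderAt_congr heq).symm.trans
      ((meromorphicOrderAt_mul hpole hga.meromorphicAt).trans ?_)
    rw [fun_meromorphicOrderAt_zpow_id_sub_const]
    rfl
  refine ⟨(hpole.fun_mul hga.meromorphicAt).congr heq, ?_, fun hc0 => ?_⟩
  · rw [hord]
    exact le_add_of_nonneg_right hga.meromorphicOrderAt_nonneg
  · have h0 : meromorphicOrderAt g x = 0 := by
      rw [← tendsto_ne_zero_iff_meromorphicOrderAt_eq_zero hga.meromorphicAt]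
      refine ⟨c, hc0, ?_⟩
      have := hga.continuousAt.tendsto
      rw [hg, Function.update_self, ← hg] at this
      exact this.mono_left nhdsWithin_le_nhds
    rw [hord, h0, add_zero]

section LFunction

variable {m : ℕ} [NeZero m]

theorem LFunction_eq_sum_Icc (Φ : ZMod m → ℂ) (s : ℂ) :
    ZMod.LFunction Φ s = (m : ℂ) ^ (-s) * ∑ k ∈ Finset.Icc 1 m,
      Φ (k : ZMod m) * HurwitzZeta.hurwitzZeta (((k : ℝ) / (m : ℝ) : ℝ) : UnitAddCircle) s := by
  rw [ZMod.LFunction]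
  congr 1
  symm
  refine Finset.sum_nbij' (fun k => (k : ZMod m)) (fun a => (a - 1).val + 1) ?_ ?_ ?_ ?_ ?_
  · simp
  · intro a _
    have := ZMod.val_lt (a - 1)
    exact Finset.mem_Icc.mpr ⟨by omega, by omega⟩
  · intro k hk
    obtain ⟨h1, h2⟩ := Finset.mem_Icc.mp hk
    have h : ((k : ZMod m) - 1) = ((k - 1 : ℕ) : ZMod m) := by
      rw [Nat.cast_sub h1, Nat.cast_one]
    rw [h, ZMod.val_cast_of_lt (by omega)]
    omega
  · intro a _
    push_cast
    rw [ZMod.natCast_zmod_val, sub_add_cancel]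
  · intro k _
    rw [ZMod.toAddCircle_natCast]

/-- The constant function is the discrete Fourier transform of a delta function, so its `L`-function
is the exponential zeta function at `0`. -/
theorem LFunction_one {s : ℂ} (hs : s ≠ 1) :
    ZMod.LFunction (fun _ : ZMod m => (1 : ℂ)) s = riemannZeta s := by
  have h := ZMod.LFunction_stdAddChar_eq_expZeta (0 : ZMod m) s (Or.inr hs)
  rw [map_zero, HurwitzZeta.expZeta_zero] at h
  rw [← h]
  simp

/-- The meromorphic continuation of the Dirichlet series `∑ (∑ l < b, q l n * n ^ l) / n ^ z`. -/
noncomputable def quasiZeta (b : ℕ) (q : ℕ → ZMod m → ℂ) (z : ℂ) : ℂ :=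
  ∑ l ∈ Finset.range b, ZMod.LFunction (q l) (z - l)

variable {b : ℕ} {q : ℕ → ZMod m → ℂ}

theorem differentiableAt_quasiZeta {z : ℂ} (hz : ∀ j ∈ Finset.Icc 1 b, z ≠ (j : ℂ)) :
    DifferentiableAt ℂ (quasiZeta b q) z := by
  refine DifferentiableAt.fun_sum fun l hl => ?_
  have h : DifferentiableAt ℂ (ZMod.LFunction (q l)) (z - l) := by
    refine ZMod.differentiableAt_LFunction _ _ (Or.inl fun h => ?_)
    refine hz (l + 1) (Finset.mem_Icc.mpr ⟨by omega, Finset.mem_range.mp hl⟩) ?_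
    rw [Nat.cast_add, Nat.cast_one, ← h]
    ring
  exact h.comp z (differentiableAt_id.sub_const _)

theorem isOpen_setOf_ne_Icc : IsOpen {z : ℂ | ∀ j ∈ Finset.Icc 1 b, z ≠ (j : ℂ)} := by
  have : {z : ℂ | ∀ j ∈ Finset.Icc 1 b, z ≠ (j : ℂ)} =
      (((Finset.Icc 1 b).image fun j : ℕ => (j : ℂ) : Finset ℂ) : Set ℂ)ᶜ := by
    ext z
    simp only [Set.mem_ofPred_eq, Finset.coe_image, Set.mem_compl_iff, Set.mem_image,
      Finset.mem_coe, not_exists, not_and]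
    exact forall₂_congr fun j _ => ne_comm
  rw [this]
  exact (Finset.finite_toSet _).isClosed.isOpen_compl

theorem analyticAt_quasiZeta {z : ℂ} (hz : ∀ j ∈ Finset.Icc 1 b, z ≠ (j : ℂ)) :
    AnalyticAt ℂ (quasiZeta b q) z := by
  rw [Complex.analyticAt_iff_eventually_differentiableAt]
  filter_upwards [isOpen_setOf_ne_Icc.mem_nhds hz] with w hw
  exact differentiableAt_quasiZeta hw

theorem tendsto_sub_mul_quasiZeta {l : ℕ} (hl : l < b) :
    Tendsto (fun z : ℂ => (z - ((l + 1 : ℕ) : ℂ)) * quasiZeta b q z) (𝓝[≠] ((l + 1 : ℕ) : ℂ))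
      (𝓝 ((∑ a, q l a) / m)) := by
  have hmaps (k : ℕ) : Tendsto (fun z : ℂ => z - k) (𝓝 ((l + 1 : ℕ) : ℂ))
      (𝓝 (((l + 1 : ℕ) : ℂ) - k)) :=
    (continuous_id.sub continuous_const).tendsto _
  have hterm (k : ℕ) : Tendsto (fun z : ℂ => (z - ((l + 1 : ℕ) : ℂ)) * ZMod.LFunction (q k) (z - k))
      (𝓝[≠] ((l + 1 : ℕ) : ℂ)) (𝓝 (if k = l then (∑ a, q l a) / m else 0)) := by
    split_ifs with hk
    · subst hk
      have h1 := ZMod.LFunction_residue_one (q k)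
      rw [← Finset.sum_div] at h1
      have h2 : Tendsto (fun z : ℂ => z - k) (𝓝[≠] ((k + 1 : ℕ) : ℂ)) (𝓝[≠] 1) := by
        refine tendsto_nhdsWithin_iff.mpr ⟨?_, ?_⟩
        · have := (hmaps k).mono_left (nhdsWithin_le_nhds (s := {((k + 1 : ℕ) : ℂ)}ᶜ))
          simpa using this
        · filter_upwards [self_mem_nhdsWithin] with z hz h
          refine hz ?_
          rw [Set.mem_singleton_iff, sub_eq_iff_eq_add] at h
          rw [Set.mem_singleton_iff, h]
          push_cast
          ring
      refine (h1.comp h2).congr fun z => ?_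
      simp only [Function.comp_apply]
      push_cast
      ring
    · have h1 : ContinuousAt (fun z : ℂ => ZMod.LFunction (q k) (z - k)) ((l + 1 : ℕ) : ℂ) := by
        have h2 : ContinuousAt (ZMod.LFunction (q k)) (((l + 1 : ℕ) : ℂ) - k) := by
          refine (ZMod.differentiableAt_LFunction _ _ (Or.inl fun h => hk ?_)).continuousAt
          push_cast at h
          have h3 : (k : ℂ) = l := by linear_combination -h
          exact_mod_cast h3
        exact h2.tendsto.comp (hmaps k)
      have h3 : Tendsto (fun z : ℂ => z - ((l + 1 : ℕ) : ℂ)) (𝓝 ((l + 1 : ℕ) : ℂ)) (𝓝 0) := by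
        simpa using hmaps (l + 1)
      simpa using (h3.mul h1.tendsto).mono_left nhdsWithin_le_nhds
  simp only [quasiZeta, Finset.mul_sum]
  have := tendsto_finsetSum (Finset.range b) fun k _ => hterm k
  rwa [Finset.sum_ite_eq' (Finset.range b) l, if_pos (Finset.mem_range.mpr hl)] at this

theorem meromorphicAt_quasiZeta_pole {j : ℕ} (hj : j ∈ Finset.Icc 1 b) :
    MeromorphicAt (quasiZeta b q) (j : ℂ) ∧ -1 ≤ meromorphicOrderAt (quasiZeta b q) (j : ℂ) ∧
      ((∑ a, q (j - 1) a) / (m : ℂ) ≠ 0 → meromorphicOrderAt (quasiZeta b q) (j : ℂ) = -1) := by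
  obtain ⟨h1, h2⟩ := Finset.mem_Icc.mp hj
  obtain ⟨l, rfl⟩ : ∃ l, j = l + 1 := ⟨j - 1, by omega⟩
  refine meromorphicAt_of_tendsto_sub_mul ?_ (tendsto_sub_mul_quasiZeta (by omega))
  have hfin : ∀ᶠ z in 𝓝[≠] ((l + 1 : ℕ) : ℂ), ∀ k ∈ Finset.Icc 1 b, z ≠ (k : ℂ) := by
    rw [eventually_all_finset]
    intro k _
    by_cases hk : k = l + 1
    · subst hk
      exact self_mem_nhdsWithin
    · exact nhdsWithin_le_nhds (isOpen_ne.mem_nhds fun h => hk (by exact_mod_cast h.symm))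
  filter_upwards [hfin] with z hz
  exact differentiableAt_quasiZeta hz

theorem meromorphic_quasiZeta : Meromorphic (quasiZeta b q) := fun z => by
  by_cases hz : ∀ j ∈ Finset.Icc 1 b, z ≠ (j : ℂ)
  · exact (analyticAt_quasiZeta hz).meromorphicAt
  · push Not at hz
    obtain ⟨j, hj, rfl⟩ := hz
    exact (meromorphicAt_quasiZeta_pole hj).1

theorem hasSum_quasiZeta {f : ℕ → ℂ}
    (hf : ∀ n : ℕ, 0 < n → f n = ∑ l ∈ Finset.range b, q l (n : ZMod m) * (n : ℂ) ^ l) {z : ℂ}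
    (hz : (b : ℝ) < z.re) :
    HasSum (fun n : ℕ => f (n + 1) * (1 / ((n + 1 : ℕ) : ℂ) ^ z)) (quasiZeta b q z) := by
  have hterm (l : ℕ) (hl : l ∈ Finset.range b) :
      HasSum (fun n => LSeries.term (fun n : ℕ => q l n) (z - l) n) (ZMod.LFunction (q l) (z - l)) := by
    have h1 : 1 < (z - l).re := by
      have h2 : ((l + 1 : ℕ) : ℝ) ≤ b := by exact_mod_cast Finset.mem_range.mp hl
      rw [Complex.sub_re, Complex.natCast_re]
      push_cast at h2
      linarith
    rw [ZMod.LFunction_eq_LSeries _ h1]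
    exact (ZMod.LSeriesSummable_of_one_lt_re (q l) h1).hasSum
  have hsum := hasSum_sum hterm
  rw [← hasSum_nat_add_iff' 1] at hsum
  simp only [Finset.range_one, Finset.sum_singleton, LSeries.term_zero, Finset.sum_const_zero,
    sub_zero] at hsum
  refine hsum.congr_fun fun n => ?_
  rw [hf _ (Nat.succ_pos n), Finset.sum_mul]
  refine Finset.sum_congr rfl fun l _ => ?_
  have h0 : ((n + 1 : ℕ) : ℂ) ≠ 0 := Nat.cast_ne_zero.mpr (Nat.succ_ne_zero n)
  rw [LSeries.term_of_ne_zero (Nat.succ_ne_zero n), Complex.cpow_sub _ _ h0, Complex.cpow_natCast]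
  field_simp

/-- A constant `w` can be split off the leading coefficients, where it contributes a multiple of the
Riemann zeta function. -/
theorem quasiZeta_eq (hb : 0 < b) (w : ℂ) {z : ℂ} (hz : z ≠ b) :
    quasiZeta b q z = w * riemannZeta (z - b + 1) +
      ∑ l ∈ Finset.range b, (m : ℂ) ^ ((l : ℂ) - z) * ∑ k ∈ Finset.Icc 1 m,
        (q l (k : ZMod m) - if l = b - 1 then w else 0) *
          HurwitzZeta.hurwitzZeta (((k : ℝ) / (m : ℝ) : ℝ) : UnitAddCircle) (z - l) := by
  have hcast : ((b - 1 : ℕ) : ℂ) = b - 1 := by rw [Nat.cast_sub hb, Nat.cast_one]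
  have h1 : z - b + 1 = z - ((b - 1 : ℕ) : ℂ) := by rw [hcast]; ring
  have h2 : z - ((b - 1 : ℕ) : ℂ) ≠ 1 := by
    intro h
    rw [hcast] at h
    exact hz (by linear_combination h)
  have h3 : w * riemannZeta (z - b + 1) = ∑ l ∈ Finset.range b,
      (m : ℂ) ^ ((l : ℂ) - z) * ∑ k ∈ Finset.Icc 1 m, (if l = b - 1 then w else 0) *
          HurwitzZeta.hurwitzZeta (((k : ℝ) / (m : ℝ) : ℝ) : UnitAddCircle) (z - l) := by
    rw [Finset.sum_eq_single (b - 1), h1, ← LFunction_one (m := m) h2, LFunction_eq_sum_Icc, neg_sub]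
    · simp only [if_true, ← Finset.mul_sum, one_mul]
      ring
    · intro l _ hl
      simp [hl]
    · intro h
      exact absurd (Finset.mem_range.mpr (by omega)) h
  rw [h3, ← Finset.sum_add_distrib, quasiZeta]
  refine Finset.sum_congr rfl fun l _ => ?_
  rw [LFunction_eq_sum_Icc, neg_sub, ← mul_add, ← Finset.sum_add_distrib]
  congr 1
  refine Finset.sum_congr rfl fun k _ => ?_
  ring

end LFunction

/-! ### Divergence to the left of the abscissa -/

/-- For `n` between `p k` and `(p + 1) k`, the terms `n ^ (-z)` have almost the same argument when
`p` is large, so that blocks of the series do not cancel. -/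
theorem not_tendsto_of_re_le {b : ℕ} (hb : 0 < b) {f : ℕ → ℕ} {V : ℝ} (hV0 : 0 < V)
    (hV : Tendsto (fun n : ℕ => (∑ j ∈ Finset.range n, (f (j + 1) : ℝ)) / (n : ℝ) ^ b) atTop (𝓝 V))
    {z : ℂ} (hz : z.re ≤ b) (s : ℂ) :
    ¬ Tendsto (fun N : ℕ => ∑ n ∈ Finset.range N, (f (n + 1) : ℂ) * (1 / ((n + 1 : ℕ) : ℂ) ^ z))
      atTop (𝓝 s) := by
  intro hs
  -- `n / (p * k) ≤ 1 + 1 / p`, so `|Im z| * log (n / (p * k)) < 1` on the block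
  obtain ⟨p, hp⟩ := exists_nat_gt |z.im|
  have hp0 : 0 < p := by exact_mod_cast (abs_nonneg _).trans_lt hp
  have hp0' : (0 : ℝ) < p := by exact_mod_cast hp0
  have hmul (c : ℕ) (hc : 0 < c) : Tendsto (fun k : ℕ => c * k) atTop atTop :=
    tendsto_id.const_mul_atTop' hc
  set S : ℕ → ℂ := fun N => ∑ n ∈ Finset.range N, (f (n + 1) : ℂ) * (1 / ((n + 1 : ℕ) : ℂ) ^ z)
  set F : ℕ → ℝ := fun n => ∑ j ∈ Finset.range n, (f (j + 1) : ℝ)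
  have hblock : Tendsto (fun k : ℕ => ‖S ((p + 1) * k) - S (p * k)‖) atTop (𝓝 0) := by
    have := ((hs.comp (hmul (p + 1) (by omega))).sub (hs.comp (hmul p hp0))).norm
    rwa [sub_self, norm_zero] at this
  have hgrowth : Tendsto (fun k : ℕ => (F ((p + 1) * k) - F (p * k)) / (((p + 1) * k : ℕ) : ℝ) ^ b)
      atTop (𝓝 (V - V * ((p : ℝ) / (p + 1)) ^ b)) := by
    refine ((hV.comp (hmul (p + 1) (by omega))).sub
      ((hV.comp (hmul p hp0)).mul_const (((p : ℝ) / (p + 1)) ^ b))).congr' ?_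
    filter_upwards [eventually_gt_atTop 0] with k hk
    have hk' : (k : ℝ) ≠ 0 := by exact_mod_cast hk.ne'
    simp only [Function.comp_apply]
    have h1 : (p : ℝ) + 1 ≠ 0 := by positivity
    rw [sub_div, div_pow]
    push_cast
    rw [mul_pow, mul_pow]
    field_simp
    rfl
  have hpos : 0 < V - V * ((p : ℝ) / (p + 1)) ^ b := by
    have : ((p : ℝ) / (p + 1)) ^ b < 1 :=
      pow_lt_one₀ (by positivity) ((div_lt_one (by positivity)).mpr (by linarith)) hb.ne'
    nlinarith
  have hle : ∀ᶠ k : ℕ in atTop,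
      (F ((p + 1) * k) - F (p * k)) / (((p + 1) * k : ℕ) : ℝ) ^ b / 2 ≤
        ‖S ((p + 1) * k) - S (p * k)‖ := by
    filter_upwards [eventually_gt_atTop 0] with k hk
    have hk' : (0 : ℝ) < k := by exact_mod_cast hk
    have hpk : p * k ≤ (p + 1) * k := Nat.mul_le_mul_right k (by omega)
    have hS : S ((p + 1) * k) - S (p * k) = ∑ n ∈ Finset.Ico (p * k) ((p + 1) * k),
        (f (n + 1) : ℂ) * (1 / ((n + 1 : ℕ) : ℂ) ^ z) :=
      (Finset.sum_Ico_eq_sub _ hpk).symm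
    have hF : F ((p + 1) * k) - F (p * k) =
        ∑ n ∈ Finset.Ico (p * k) ((p + 1) * k), (f (n + 1) : ℝ) :=
      (Finset.sum_Ico_eq_sub _ hpk).symm
    -- rotate the block by the argument at its start
    set u : ℂ := Complex.exp ((z.im * Real.log (p * k) : ℝ) * Complex.I) with hu
    have hu1 : ‖u‖ = 1 := Complex.norm_exp_ofReal_mul_I _
    have hterm (n : ℕ) (hn : n ∈ Finset.Ico (p * k) ((p + 1) * k)) :
        1 / (((p + 1) * k : ℕ) : ℝ) ^ b / 2 ≤ (u * (1 / ((n + 1 : ℕ) : ℂ) ^ z)).re := by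
      obtain ⟨hn1, hn2⟩ := Finset.mem_Ico.mp hn
      have hn0 : (0 : ℝ) < ((n + 1 : ℕ) : ℝ) := by exact_mod_cast Nat.succ_pos n
      have hlog : u * (1 / ((n + 1 : ℕ) : ℂ) ^ z) =
          Complex.exp ((-(z.re * Real.log (n + 1 : ℕ)) : ℝ) +
            (z.im * (Real.log (p * k) - Real.log (n + 1 : ℕ)) : ℝ) * Complex.I) := by
        rw [one_div, ← Complex.cpow_neg, Complex.cpow_def_of_ne_zero (by exact_mod_cast hn0.ne'), hu,
          ← Complex.exp_add, ← Complex.ofReal_natCast, ← Complex.ofReal_log hn0.le]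
        congr 1
        push_cast
        linear_combination (Real.log (n + 1) : ℂ) * Complex.re_add_im z
      have hangle : |z.im * (Real.log (p * k) - Real.log (n + 1 : ℕ))| ≤ 1 := by
        have h1 : (p * k : ℝ) ≤ (n + 1 : ℕ) := by
          have : p * k ≤ n + 1 := by omega
          exact_mod_cast this
        have h2 : ((n + 1 : ℕ) : ℝ) ≤ (p + 1) * k := by
          have : n + 1 ≤ (p + 1) * k := by omega
          exact_mod_cast this
        have h3 : 0 < (p * k : ℝ) := by positivity
        have h4 : Real.log (n + 1 : ℕ) - Real.log (p * k) ≤ 1 / p := by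
          rw [← Real.log_div hn0.ne' h3.ne']
          refine (Real.log_le_sub_one_of_pos (by positivity)).trans ?_
          rw [sub_le_iff_le_add, div_le_iff₀ h3]
          refine h2.trans (le_of_eq ?_)
          field_simp
          ring
        have h5 : 0 ≤ Real.log (n + 1 : ℕ) - Real.log (p * k) :=
          sub_nonneg.mpr (Real.log_le_log h3 h1)
        rw [abs_mul, abs_sub_comm, abs_of_nonneg h5]
        calc |z.im| * (Real.log (n + 1 : ℕ) - Real.log (p * k)) ≤ p * (1 / p) :=
              mul_le_mul hp.le h4 h5 hp0'.le
          _ = 1 := by field_simp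
      have hcos : 1 / 2 ≤ Real.cos (z.im * (Real.log (p * k) - Real.log (n + 1 : ℕ))) := by
        refine le_trans ?_ (Real.one_sub_sq_div_two_le_cos)
        have := sq_le_one_iff_abs_le_one _ |>.mpr hangle
        linarith
      have hre : (u * (1 / ((n + 1 : ℕ) : ℂ) ^ z)).re = Real.exp (-(z.re * Real.log (n + 1 : ℕ))) *
          Real.cos (z.im * (Real.log (p * k) - Real.log (n + 1 : ℕ))) := by
        rw [hlog, Complex.exp_re]
        simp
      have hexp : 1 / (((p + 1) * k : ℕ) : ℝ) ^ b ≤ Real.exp (-(z.re * Real.log (n + 1 : ℕ))) := by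
        have h1 : 1 / ((n + 1 : ℕ) : ℝ) ^ b = Real.exp (-(b * Real.log (n + 1 : ℕ))) := by
          rw [Real.exp_neg, one_div, Real.exp_nat_mul, Real.exp_log hn0]
        have h2 : 1 / (((p + 1) * k : ℕ) : ℝ) ^ b ≤ 1 / ((n + 1 : ℕ) : ℝ) ^ b := by
          refine one_div_le_one_div_of_le (by positivity) (pow_le_pow_left₀ hn0.le ?_ _)
          exact_mod_cast hn2
        rw [h1] at h2
        refine h2.trans (Real.exp_le_exp.mpr (neg_le_neg ?_))
        refine mul_le_mul_of_nonneg_right hz (Real.log_nonneg ?_)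
        exact_mod_cast Nat.succ_le_succ (Nat.zero_le n)
      rw [hre]
      have hpos : 0 ≤ 1 / (((p + 1) * k : ℕ) : ℝ) ^ b := by positivity
      calc 1 / (((p + 1) * k : ℕ) : ℝ) ^ b / 2 = 1 / (((p + 1) * k : ℕ) : ℝ) ^ b * (1 / 2) := by ring
        _ ≤ _ := mul_le_mul hexp hcos (by norm_num) (hpos.trans hexp)
    calc (F ((p + 1) * k) - F (p * k)) / (((p + 1) * k : ℕ) : ℝ) ^ b / 2
        = ∑ n ∈ Finset.Ico (p * k) ((p + 1) * k),
            (f (n + 1) : ℝ) * (1 / (((p + 1) * k : ℕ) : ℝ) ^ b / 2) := by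
          rw [hF, ← Finset.sum_mul]
          ring
      _ ≤ ∑ n ∈ Finset.Ico (p * k) ((p + 1) * k),
            (f (n + 1) : ℝ) * (u * (1 / ((n + 1 : ℕ) : ℂ) ^ z)).re :=
          Finset.sum_le_sum fun n hn => mul_le_mul_of_nonneg_left (hterm n hn) (Nat.cast_nonneg _)
      _ = (u * (S ((p + 1) * k) - S (p * k))).re := by
          rw [hS, Finset.mul_sum, Complex.re_sum]
          refine Finset.sum_congr rfl fun n _ => ?_
          rw [mul_left_comm, ← Complex.ofReal_natCast (f (n + 1)), Complex.re_ofReal_mul]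
      _ ≤ ‖u * (S ((p + 1) * k) - S (p * k))‖ := Complex.re_le_norm _
      _ = ‖S ((p + 1) * k) - S (p * k)‖ := by rw [norm_mul, hu1, one_mul]
  have := le_of_tendsto_of_tendsto (hgrowth.div_const 2) hblock hle
  linarith

/-! ### The stable zeta series as a Dirichlet series -/

section graph

variable {α β : Type*} {G : Graph α β} [Fintype E(G)]

theorem size_zero {ι : Type*} [Fintype ι] : size (0 : ι → ℤ) = 0 := size_eq_zero.mpr rfl

theorem card_sphere_zero : (sphere G 0).card = 1 := by
  rw [Finset.card_eq_one]
  refine ⟨0, ?_⟩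
  ext θ
  rw [mem_sphere, size_eq_zero, Finset.mem_singleton]
  exact ⟨fun h => Subtype.ext h, fun h => by rw [h]; rfl⟩

theorem ncard_size_le (n : ℕ) : {θ : H1 G ℤ | size θ.1 ≤ n}.ncard =
    ∑ j ∈ Finset.range n, (sphere G (j + 1)).card + 1 := by
  classical
  rw [Set.ncard_eq_toFinset_card _ (finite_size_le n)]
  have h := Finset.sum_range_succ' (fun j => (sphere G j).card) n
  rw [card_sphere_zero] at h
  rw [← h,
    Finset.card_eq_sum_card_fiberwise (f := fun θ : H1 G ℤ => size θ.1) (t := Finset.range (n + 1))]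
  · refine Finset.sum_congr rfl fun j hj => ?_
    congr 1
    ext θ
    have := Finset.mem_range.mp hj
    simp only [Finset.mem_filter, Set.Finite.mem_toFinset, Set.mem_ofPred_eq, mem_sphere]
    omega
  · intro θ hθ
    have : size θ.1 ≤ n := by simpa using hθ
    exact Finset.mem_coe.mpr (Finset.mem_range.mpr (Nat.lt_succ_of_le this))

theorem tendsto_sum_card_sphere_div (hG : Connected G) (hb : 0 < betti G) :
    Tendsto (fun n : ℕ => (∑ j ∈ Finset.range n, ((sphere G (j + 1)).card : ℝ)) / (n : ℝ) ^ betti G)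
      atTop (𝓝 (ballVolume G)) := by
  have h1 : Tendsto (fun n : ℕ => 1 / (n : ℝ) ^ betti G) atTop (𝓝 0) := by
    have := (tendsto_pow_atTop hb.ne').comp (tendsto_natCast_atTop_atTop (R := ℝ))
    simp only [one_div]
    exact this.inv_tendsto_atTop
  have h2 := (tendsto_ncard_div hG).sub h1
  rw [sub_zero] at h2
  refine h2.congr fun n => ?_
  rw [ncard_size_le, ← sub_div]
  push_cast
  rw [add_sub_cancel_right]

theorem size_pos {θ : H1 G ℤ} (h : θ ≠ 0) : size θ.1 ≠ 0 := fun h0 =>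
  h (Subtype.ext (size_eq_zero.mp h0))

theorem stableNorm_toReal (hG : Connected G) (θ : H1 G ℤ) :
    stableNorm G (toReal G θ) = size θ.1 := by
  rw [stableNorm_eq hG, l1_toReal]

theorem finite_stableNorm_le (hG : Connected G) (t : ℝ) :
    {θ : {θ : H1 G ℤ // θ ≠ 0} | stableNorm G (toReal G θ) ≤ t}.Finite := by
  refine ((finite_size_le ⌊t⌋₊).preimage Subtype.val_injective.injOn).subset fun θ hθ => ?_
  have h : (size θ.1.1 : ℝ) ≤ t := by
    rw [← stableNorm_toReal hG]
    exact hθ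
  exact (Nat.le_floor_iff' (size_pos θ.2)).mpr h

theorem finsum_stableNorm_le (hG : Connected G) (z : ℂ) (t : ℝ) :
    ∑ᶠ θ ∈ {θ : {θ : H1 G ℤ // θ ≠ 0} | stableNorm G (toReal G θ) ≤ t},
      1 / ((stableNorm G (toReal G θ) : ℝ) : ℂ) ^ z =
    ∑ n ∈ Finset.range ⌊t⌋₊, ((sphere G (n + 1)).card : ℂ) * (1 / ((n + 1 : ℕ) : ℂ) ^ z) := by
  classical
  rw [finsum_mem_eq_finite_toFinset_sum _ (finite_stableNorm_le hG t),
    ← Finset.sum_fiberwise_of_maps_to (t := Finset.range ⌊t⌋₊) (g := fun θ => size θ.1.1 - 1)]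
  · refine Finset.sum_congr rfl fun n hn => ?_
    have hn' : (((n + 1 : ℕ) : ℝ)) ≤ t :=
      (Nat.le_floor_iff' (Nat.succ_ne_zero n)).mp (Finset.mem_range.mp hn)
    rw [← nsmul_eq_mul, ← Finset.sum_const]
    refine Finset.sum_bij' (fun θ _ => θ.1) (fun θ hθ => ⟨θ, ?_⟩) ?_ ?_ ?_ ?_ ?_
    · rintro rfl
      rw [mem_sphere] at hθ
      exact (Nat.succ_ne_zero n) (hθ.symm.trans size_zero)
    · intro θ hθ
      have h1 := (Finset.mem_filter.mp hθ).2
      have h2 := size_pos θ.2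
      rw [mem_sphere]
      omega
    · intro θ hθ
      rw [mem_sphere] at hθ
      rw [Finset.mem_filter, Set.Finite.mem_toFinset, Set.mem_ofPred_eq, stableNorm_toReal hG]
      dsimp only
      rw [hθ]
      exact ⟨hn', by omega⟩
    · intro _ _
      rfl
    · intro _ _
      rfl
    · intro θ hθ
      have h1 := (Finset.mem_filter.mp hθ).2
      have h2 := size_pos θ.2
      rw [stableNorm_toReal hG, show size θ.1.1 = n + 1 by omega, Complex.ofReal_natCast]
  · intro θ hθ
    rw [Set.Finite.mem_toFinset, Set.mem_ofPred_eq, stableNorm_toReal hG] at hθ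
    have h2 := size_pos θ.2
    have h3 := (Nat.le_floor_iff' h2).mpr hθ
    exact Finset.mem_range.mpr (by omega)

theorem stableZetaConvergesTo_iff (hG : Connected G) (z s : ℂ) :
    StableZetaConvergesTo G z s ↔ Tendsto (fun N : ℕ => ∑ n ∈ Finset.range N,
      ((sphere G (n + 1)).card : ℂ) * (1 / ((n + 1 : ℕ) : ℂ) ^ z)) atTop (𝓝 s) := by
  unfold StableZetaConvergesTo ZetaConvergesTo
  rw [and_iff_right (finite_stableNorm_le hG)]
  simp only [finsum_stableNorm_le hG]
  constructor
  · intro h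
    refine (h.comp tendsto_natCast_atTop_atTop).congr fun N => ?_
    simp only [Function.comp_apply, Nat.floor_natCast]
  · exact fun h => h.comp tendsto_nat_floor_atTop

end graph

end StableZeta

theorem theorem3p2 {α β : Type*} (G : Graph α β) [Finite V(G)] [Fintype E(G)]
    (hG : StableZeta.Connected G) (b : ℕ) (hb : b = StableZeta.betti G) (hb1 : 1 ≤ b)
    (V : ℝ) (hV : V = StableZeta.ballVolume G) :
    -- the series converges exactly in the half-plane `Re z > b`
    (∀ z : ℂ, (∃ s : ℂ, StableZeta.StableZetaConvergesTo G z s) ↔ (b : ℝ) < z.re) ∧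
    ∃ Z : ℂ → ℂ,
      -- `Z` is a meromorphic extension of the sum of the series
      (∀ z : ℂ, (b : ℝ) < z.re → StableZeta.StableZetaConvergesTo G z (Z z)) ∧
      Meromorphic Z ∧
      -- its poles are simple and lie in `{1, …, b}`
      (∀ z : ℂ, (∀ j ∈ Finset.Icc 1 b, z ≠ (j : ℂ)) → AnalyticAt ℂ Z z) ∧
      (∀ j ∈ Finset.Icc 1 b, -1 ≤ meromorphicOrderAt Z (j : ℂ)) ∧
      -- `z = b` is a simple pole, with residue `b V`
      meromorphicOrderAt Z (b : ℂ) = -1 ∧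
      Tendsto (fun z : ℂ => (z - (b : ℂ)) * Z z) (𝓝[≠] (b : ℂ)) (𝓝 ((b : ℂ) * (V : ℂ))) ∧
      -- the explicit formula
      ∃ m : ℕ, 0 < m ∧ ∃ p : ℕ → ℕ → ℚ,
        ∀ z : ℂ, (∀ j ∈ Finset.Icc 1 b, z ≠ (j : ℂ)) →
          Z z = (b : ℂ) * (V : ℂ) * riemannZeta (z - (b : ℂ) + 1) +
            ∑ l ∈ Finset.range b, (m : ℂ) ^ ((l : ℂ) - z) *
              ∑ k ∈ Finset.Icc 1 m, (p l k : ℂ) *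
                HurwitzZeta.hurwitzZeta (((k : ℝ) / (m : ℝ) : ℝ) : UnitAddCircle) (z - (l : ℂ)) := by
  open StableZeta in
  have hgrowth := tendsto_sum_card_sphere_div hG (hb ▸ hb1)
  have hVpos := ballVolume_pos hG
  obtain ⟨m, hm0, hdiff⟩ : ∃ m, 0 < m ∧
      DiffVanishes m (betti G) fun n => (sphere G n).card :=
    ⟨_, Nat.factorial_pos _, diffVanishes_card_sphere G⟩
  rw [← hb, ← hV] at hgrowth
  rw [← hV] at hVpos
  rw [← hb] at hdiff
  have : NeZero m := ⟨hm0.ne'⟩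
  obtain ⟨q, hq⟩ := exists_quasiPolynomial hb1 hdiff
  have hqR (n : ℕ) (hn : 0 < n) : ((sphere G n).card : ℝ) =
      ∑ l ∈ Finset.range b, (q l (n : ZMod m) : ℝ) * (n : ℝ) ^ l := by
    exact_mod_cast congrArg (fun x : ℚ => (x : ℝ)) (hq n hn)
  have hqC (n : ℕ) (hn : 0 < n) : ((sphere G n).card : ℂ) =
      ∑ l ∈ Finset.range b, (q l (n : ZMod m) : ℂ) * (n : ℂ) ^ l := by
    exact_mod_cast congrArg (fun x : ℚ => (x : ℂ)) (hq n hn)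
  have hlead := sum_leadingCoeff_eq (f := fun n => ((sphere G n).card : ℝ))
    (q := fun l a => (q l a : ℝ)) hb1 hqR hgrowth
  have hmC : (m : ℂ) ≠ 0 := Nat.cast_ne_zero.mpr hm0.ne'
  have hleadC : (∑ a, (q (b - 1) a : ℂ)) / (m : ℂ) = (b : ℂ) * (V : ℂ) := by
    rw [div_eq_iff hmC, mul_comm]
    exact_mod_cast congrArg (fun x : ℝ => (x : ℂ)) hlead
  -- the residue is rational, so that it can be absorbed into the coefficients `p`
  have hw : (((∑ a, q (b - 1) a) / m : ℚ) : ℂ) = (b : ℂ) * (V : ℂ) := by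
    rw [← hleadC]
    push_cast
    rfl
  have hbV : (b : ℂ) * (V : ℂ) ≠ 0 :=
    mul_ne_zero (Nat.cast_ne_zero.mpr (Nat.one_le_iff_ne_zero.mp hb1))
      (Complex.ofReal_ne_zero.mpr hVpos.ne')
  have hbmem : b ∈ Finset.Icc 1 b := Finset.mem_Icc.mpr ⟨hb1, le_rfl⟩
  have hconv (z : ℂ) (hz : (b : ℝ) < z.re) :
      StableZetaConvergesTo G z (quasiZeta b (fun l a => (q l a : ℂ)) z) := by
    rw [stableZetaConvergesTo_iff hG]
    have h := hasSum_quasiZeta (f := fun n => ((sphere G n).card : ℂ))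
      (q := fun l a => (q l a : ℂ)) hqC hz
    exact h.tendsto_sum_nat
  obtain ⟨p, hp⟩ : ∃ p : ℕ → ℕ → ℚ, ∀ z : ℂ, z ≠ b →
      quasiZeta b (fun l a => (q l a : ℂ)) z = (b : ℂ) * (V : ℂ) * riemannZeta (z - (b : ℂ) + 1) +
        ∑ l ∈ Finset.range b, (m : ℂ) ^ ((l : ℂ) - z) * ∑ k ∈ Finset.Icc 1 m, (p l k : ℂ) *
          HurwitzZeta.hurwitzZeta (((k : ℝ) / (m : ℝ) : ℝ) : UnitAddCircle) (z - (l : ℂ)) := by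
    refine ⟨fun l k => q l (k : ZMod m) - if l = b - 1 then (∑ a, q (b - 1) a) / m else 0,
      fun z hz => ?_⟩
    rw [quasiZeta_eq hb1 ((b : ℂ) * (V : ℂ)) hz, ← hw]
    simp only [Rat.cast_sub, apply_ite (Rat.cast : ℚ → ℂ), Rat.cast_zero]
  have hres := tendsto_sub_mul_quasiZeta (b := b) (q := fun l a => (q l a : ℂ)) (l := b - 1)
    (by omega)
  rw [Nat.sub_add_cancel hb1, hleadC] at hres
  have hpole := fun j hj => meromorphicAt_quasiZeta_pole (b := b) (q := fun l a => (q l a : ℂ))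
    (j := j) hj
  have hord := (hpole b hbmem).2.2 (by rw [hleadC]; exact hbV)
  have hdiv (z s : ℂ) (hs : StableZetaConvergesTo G z s) : (b : ℝ) < z.re := by
    by_contra! hz
    rw [stableZetaConvergesTo_iff hG] at hs
    exact not_tendsto_of_re_le (f := fun n => (sphere G n).card) hb1 hVpos hgrowth hz s hs
  refine ⟨fun z => ⟨fun ⟨s, hs⟩ => hdiv z s hs, fun hz => ⟨_, hconv z hz⟩⟩,
    quasiZeta b (fun l a => (q l a : ℂ)), hconv, meromorphic_quasiZeta,
    fun z hz => analyticAt_quasiZeta hz, fun j hj => (hpole j hj).2.1, hord, hres, m, hm0, p, ?_⟩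
  exact fun z hz => hp z (hz b hbmem)
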